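/- Let $G=(V,E)$ be a finite connected simple graph with $n=|V|$, $m=|E|\ge 1$ and maximum degree $\Delta$, let $d(v)$ denote the degree of $v$, and let $x\in(0,1)$. For $A\subseteq E$ let $\partial A$ be the set of vertices of odd degree in $(V,A)$, let $\mathcal C_k=\{A\subseteq E:|\partial A|=k\}$ and $\mathcal W=\mathcal C_0\cup\mathcal C_2$. Let $\pi_x$ be the probability measure on $\mathcal W$ given by $$\pi_x(A)=\frac{x^{|A|}\psi(A)}{n\sum_{B\in\mathcal C_0}x^{|B|}+2\sum_{B\in\mathcal C_2}x^{|B|}},\qquad \psi(A)=n\ \text{on }\mathcal C_0,\quad \psi(A)=2\ \text{on }\mathcal C_2 .$$ The worm process with parameter $x$ is the Markov chain on $\mathcal W$ whose transition matrix $P_x$ has, for $uv\in E$ and $A,\ A\triangle uv\in\mathcal W$, the entries $$P_x(A,A\triangle uv)=\begin{cases}x^{\mathbf 1(uv\notin A)}\,\frac1{2n}\left(\frac1{d(u)}+\frac1{d(v)}\right), & A\in\mathcal C_0,\\[4pt] x^{\mathbf 1(uv\notin A)}\,\frac14\left(\frac1{d(u)}+\frac1{d(v)}\right), & A\triangle uv\in\mathcal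 C_0,\\[4pt] \min\left(\frac{d(u)}{d(v)}\,x^{\mathbf 1(uv\notin A)-\mathbf 1(uv\in A)},\,1\right)\frac1{4d(u)}, & A,\ A\triangle uv\in\mathcal C_2,\ u\in\partial A,\end{cases}$$ all other off-diagonal entries equal to $0$, and diagonal entries such that the rows sum to $1$. **Lemma.** Let $(X_t)_{t\ge 0}$ be a worm process on $G$ with parameter $x$ and $X_0=\emptyset$ (the empty edge set). Let $f:\mathcal W\to[0,\infty)$ be not identically zero, let $\mathbb E_{\pi_x}(f)=\sum_{A\in\mathcal W}\pi_x(A)f(A)$ and $\|f\|_\infty=\max_{A\in\mathcal W}f(A)$, and let $\epsilon,\delta\in(0,1)$. Set $$\tau=\left\lceil 4\left(\log 2+\frac{\log(2\delta^{-1})}{m}\right)\Delta\,m^2\,n^4\right\rceil,\qquad N_0=\left\lceil 16\,\epsilon^{-2}\delta^{-1}\Delta\,m\,n^4\,\frac{\|f\|_\infty}{\mathbb E_{\pi_x}(f)}\right\rceil .$$ Then for every integer $N\ge N_0$ $$\mathbb P\left(\left|\frac1N\sum_{t=\tau+1}^{\tau+N}f(X_t)-\mathbb E_{\pi_x}(f)\right|\ge\epsilon\,\mathbb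 E_{\pi_x}(f)\right)\le\delta ,$$ and the sample mean is an $(\epsilon,\delta)$-approximation of $\mathbb E_{\pi_x}(f)$, that is, $$\mathbb P\left(\left|\frac1N\sum_{t=\tau+1}^{\tau+N}f(X_t)-\mathbb E_{\pi_x}(f)\right|\le\epsilon\,\mathbb E_{\pi_x}(f)\right)\ge 1-\delta .$$ Moreover, with $N=N_0$ the number of steps of the process that are used satisfies $$N_0+\tau\le C\,\Delta\,m\,n^4\left[m+\epsilon^{-2}\delta^{-1}\frac{\|f\|_\infty}{\mathbb E_{\pi_x}(f)}\right]$$ with an absolute constant $C>0$ (independent of $G$, $x$, $f$, $\epsilon$ and $\delta$). -/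

import Mathlib

open MeasureTheory
open scoped BigOperators

universe u v

namespace Worm

noncomputable section

section Configurations

variable {V : Type u} [Fintype V] [DecidableEq V]

/-- The degree `d_A(v)` of the vertex `v` in the spanning subgraph `(V, A)`. -/
def degreeIn (A : Finset (Sym2 V)) (v : V) : ℕ :=
  (Finset.univ.filter fun u => s(u, v) ∈ A).card

/-- The set `∂A` of odd vertices of the spanning subgraph `(V, A)`. -/
def boundary (A : Finset (Sym2 V)) : Finset V :=
  Finset.univ.filter fun v => Odd (degreeIn A v)

variable (G : SimpleGraph V) [DecidableRel G.Adj]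

/-- The family `C_k` of all edge sets `A ⊆ E` with exactly `k` odd vertices. -/
def oddFamily (k : ℕ) : Finset (Finset (Sym2 V)) :=
  G.edgeFinset.powerset.filter fun A => (boundary A).card = k

/-- The configuration space `W = C_0 ∪ C_2`. -/
def configurations : Finset (Finset (Sym2 V)) :=
  oddFamily G 0 ∪ oddFamily G 2

/-- The configuration space `W`, as a type. -/
abbrev State : Type u := {A : Finset (Sym2 V) // A ∈ configurations G}

/-- The empty edge set is a state. -/
theorem empty_mem_configurations : (∅ : Finset (Sym2 V)) ∈ configurations G := by
  simp [configurations, oddFamily, boundary, degreeIn]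

/-- The empty configuration. -/
def emptyState : State G := ⟨∅, empty_mem_configurations G⟩

end Configurations

/-- The measure `λ_x(S) = ∑_{A ∈ S} x^{|A|}` on sets of edge sets. -/
def weight {V : Type u} (x : ℝ) (S : Finset (Finset (Sym2 V))) : ℝ :=
  ∑ A ∈ S, x ^ A.card

section Dynamics

variable {V : Type u} [Fintype V] [DecidableEq V] (G : SimpleGraph V) [DecidableRel G.Adj]

/-- The factor `ψ(A)`: `n` on `C_0` and `2` on `C_2`. -/
def psi (A : State G) : ℝ :=
  if (A : Finset (Sym2 V)) ∈ oddFamily G 0 then (Fintype.card V : ℝ) else 2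

/-- The Prokof'ev-Svistunov probability `π_x(A)` of a state `A`. -/
def psMeasure (x : ℝ) (A : State G) : ℝ :=
  x ^ (A : Finset (Sym2 V)).card * psi G A /
    (Fintype.card V * weight x (oddFamily G 0) + 2 * weight x (oddFamily G 2))

/-- The expectation `E_{π_x}(f)`. -/
def psExpectation (x : ℝ) (f : State G → ℝ) : ℝ :=
  ∑ A, psMeasure G x A * f A

/-- The probability that the lazy Metropolis chain at `A` chooses first the vertex `u`, then its
neighbour `v`, proposes the flip of the edge `uv` leading to `B`, and accepts. In the last case
`A` and `B` both lie in `C_2`. -/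
def flipProbability (x : ℝ) (A B : State G) (u v : V) : ℝ :=
  if (A : Finset (Sym2 V)) ∈ oddFamily G 0 then
    (if s(u, v) ∈ (A : Finset (Sym2 V)) then 1 else x) *
      (1 / (2 * Fintype.card V) * (1 / G.degree u))
  else if (B : Finset (Sym2 V)) ∈ oddFamily G 0 then
    (if s(u, v) ∈ (A : Finset (Sym2 V)) then 1 else x) * (1 / 4 * (1 / G.degree u))
  else if u ∈ boundary (A : Finset (Sym2 V)) then
    min ((G.degree u : ℝ) / G.degree v * (if s(u, v) ∈ (A : Finset (Sym2 V)) then x⁻¹ else x)) 1 *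
      (1 / (4 * G.degree u))
  else 0

/-- Off-diagonal transition probabilities of the worm process: the sum over all ordered pairs
`(u, v)` of adjacent vertices with `B = A △ uv`. -/
def moveProbability (x : ℝ) (A B : State G) : ℝ :=
  ∑ u, ∑ v ∈ G.neighborFinset u,
    if (B : Finset (Sym2 V)) = symmDiff (A : Finset (Sym2 V)) {s(u, v)} then
      flipProbability G x A B u v
    else 0

/-- The transition matrix `P_x` of the worm process. -/
def transitionMatrix (x : ℝ) : Matrix (State G) (State G) ℝ := fun A B =>
  if A = B then 1 - ∑ B' ∈ Finset.univ.erase A, moveProbability G x A B'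
  else moveProbability G x A B

end Dynamics

section Explicit

variable {V : Type u} [Fintype V] [DecidableEq V] (G : SimpleGraph V) [DecidableRel G.Adj]

/-- Flipping one edge changes exactly the parities at its two endpoints. -/
theorem boundary_flip (A : Finset (Sym2 V)) {u v : V} (huv : u ≠ v) (w : V) :
    w ∈ boundary (symmDiff A {s(u, v)}) ↔ ¬ (w ∈ boundary A ↔ (w = u ∨ w = v)) := by
  have key : ∀ (B : Finset (Sym2 V)) (a b : V), s(a, b) ∉ B →
      degreeIn (insert s(a, b) B) b = degreeIn B b + 1 := by
    intro B a b hab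
    unfold degreeIn
    have : (Finset.univ.filter fun c => s(c, b) ∈ insert s(a, b) B) =
        insert a (Finset.univ.filter fun c => s(c, b) ∈ B) := by
      ext c
      simp only [Finset.mem_filter, Finset.mem_univ, true_and, Finset.mem_insert, Sym2.eq_iff]
      constructor
      · rintro ((h | h) | h)
        · exact Or.inl h.1
        · exact Or.inl (h.1.trans h.2)
        · exact Or.inr h
      · rintro (h | h)
        · exact Or.inl (Or.inl ⟨h, trivial⟩)
        · exact Or.inr h
    rw [this, Finset.card_insert_of_notMem (by simpa using hab)]
  have key' : ∀ (B : Finset (Sym2 V)), s(u, v) ∉ B → w ≠ u → w ≠ v →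
      degreeIn (insert s(u, v) B) w = degreeIn B w := by
    intro B _ h1 h2
    unfold degreeIn
    congr 1
    ext c
    simp only [Finset.mem_filter, Finset.mem_univ, true_and, Finset.mem_insert, Sym2.eq_iff]
    tauto
  have ins : ∀ (B : Finset (Sym2 V)), s(u, v) ∉ B →
      (w ∈ boundary (insert s(u, v) B) ↔ ¬ (w ∈ boundary B ↔ (w = u ∨ w = v))) := by
    intro B hB
    simp only [boundary, Finset.mem_filter, Finset.mem_univ, true_and]
    by_cases h1 : w = u
    · subst h1
      rw [Sym2.eq_swap, key B v w (by rwa [Sym2.eq_swap])]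
      simp [Nat.odd_add_one]
    · by_cases h2 : w = v
      · subst h2
        rw [key B u w hB]
        simp [Nat.odd_add_one]
      · rw [key' B hB h1 h2]
        simp [h1, h2]
  by_cases h : s(u, v) ∈ A
  · have e1 : symmDiff A {s(u, v)} = A.erase s(u, v) := by
      ext c
      simp only [Finset.mem_symmDiff, Finset.mem_singleton, Finset.mem_erase]
      constructor
      · rintro (h' | h')
        · exact ⟨h'.2, h'.1⟩
        · exact absurd (h'.1 ▸ h) h'.2
      · exact fun h' => Or.inl ⟨h'.2, h'.1⟩
    have h3 := ins (A.erase s(u, v)) (Finset.notMem_erase _ _)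
    rw [Finset.insert_erase h] at h3
    rw [e1]
    tauto
  · have e1 : symmDiff A {s(u, v)} = insert s(u, v) A := by
      ext c
      simp only [Finset.mem_symmDiff, Finset.mem_singleton, Finset.mem_insert]
      constructor
      · tauto
      · rintro (h' | h')
        · exact Or.inr ⟨h', h' ▸ h⟩
        · exact Or.inl ⟨h', fun e => h (e ▸ h')⟩
    rw [e1]
    exact ins A h

variable {G}

/-- For an edge `uv`, exactly the two orderings of `uv` contribute to the transition
`A → A △ uv`. -/
theorem transitionMatrix_flip (x : ℝ) {A B : State G} {u v : V} (huv : G.Adj u v)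
    (hB : (B : Finset (Sym2 V)) = symmDiff (A : Finset (Sym2 V)) {s(u, v)}) :
    transitionMatrix G x A B = flipProbability G x A B u v + flipProbability G x A B v u := by
  have hAB : A ≠ B := by
    intro h
    have h2 : (A : Finset (Sym2 V)) = symmDiff (A : Finset (Sym2 V)) {s(u, v)} := by
      rw [← hB, h]
    have h3 := symmDiff_eq_left.mp h2.symm
    simp at h3
  have inj : ∀ a b : V,
      ((B : Finset (Sym2 V)) = symmDiff (A : Finset (Sym2 V)) {s(a, b)}) ↔
        ((a = u ∧ b = v) ∨ (a = v ∧ b = u)) := by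
    intro a b
    rw [hB, symmDiff_right_inj, Finset.singleton_inj, eq_comm, Sym2.eq_iff]
  rw [transitionMatrix, if_neg hAB, moveProbability]
  simp only [inj]
  rw [Finset.sum_sigma', Finset.sum_ite, Finset.sum_const_zero, add_zero]
  have hs : (Finset.univ.sigma fun a => G.neighborFinset a).filter
      (fun p : (_ : V) × V => (p.1 = u ∧ p.2 = v) ∨ (p.1 = v ∧ p.2 = u)) =
      {⟨u, v⟩, ⟨v, u⟩} := by
    ext ⟨a, b⟩
    simp only [Finset.mem_filter, Finset.mem_sigma, Finset.mem_univ, true_and,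
      SimpleGraph.mem_neighborFinset, Finset.mem_insert, Finset.mem_singleton, Sigma.mk.injEq,
      heq_eq_eq]
    constructor
    · exact fun h => h.2
    · rintro (⟨rfl, rfl⟩ | ⟨rfl, rfl⟩)
      · exact ⟨huv, Or.inl ⟨rfl, rfl⟩⟩
      · exact ⟨huv.symm, Or.inr ⟨rfl, rfl⟩⟩
  rw [hs, Finset.sum_pair]
  intro h
  exact huv.ne (by simpa using congrArg Sigma.fst h)

/-- The transition probabilities out of `C_0`. -/
theorem transitionMatrix_from_zero (x : ℝ) {A B : State G} {u v : V} (huv : G.Adj u v)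
    (hB : (B : Finset (Sym2 V)) = symmDiff (A : Finset (Sym2 V)) {s(u, v)})
    (hA0 : (A : Finset (Sym2 V)) ∈ oddFamily G 0) :
    transitionMatrix G x A B = (if s(u, v) ∈ (A : Finset (Sym2 V)) then 1 else x) *
      (1 / (2 * Fintype.card V)) * (1 / G.degree u + 1 / G.degree v) := by
  rw [transitionMatrix_flip x huv hB]
  simp only [flipProbability, if_pos hA0, Sym2.eq_swap (a := v) (b := u)]
  ring

/-- The transition probabilities from `C_2` into `C_0`. -/
theorem transitionMatrix_to_zero (x : ℝ) {A B : State G} {u v : V} (huv : G.Adj u v)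
    (hB : (B : Finset (Sym2 V)) = symmDiff (A : Finset (Sym2 V)) {s(u, v)})
    (hA0 : (A : Finset (Sym2 V)) ∉ oddFamily G 0) (hB0 : (B : Finset (Sym2 V)) ∈ oddFamily G 0) :
    transitionMatrix G x A B = (if s(u, v) ∈ (A : Finset (Sym2 V)) then 1 else x) *
      (1 / 4) * (1 / G.degree u + 1 / G.degree v) := by
  rw [transitionMatrix_flip x huv hB]
  simp only [flipProbability, if_neg hA0, if_pos hB0, Sym2.eq_swap (a := v) (b := u)]
  ring

/-- The transition probabilities from `C_2` to `C_2`. -/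
theorem transitionMatrix_two_two (x : ℝ) {A B : State G} {u v : V} (huv : G.Adj u v)
    (hB : (B : Finset (Sym2 V)) = symmDiff (A : Finset (Sym2 V)) {s(u, v)})
    (hA2 : (A : Finset (Sym2 V)) ∈ oddFamily G 2) (hB2 : (B : Finset (Sym2 V)) ∈ oddFamily G 2)
    (hu : u ∈ boundary (A : Finset (Sym2 V))) :
    transitionMatrix G x A B =
      min ((G.degree u : ℝ) / G.degree v *
        (if s(u, v) ∈ (A : Finset (Sym2 V)) then x⁻¹ else x)) 1 * (1 / (4 * G.degree u)) := by
  have cA := (Finset.mem_filter.mp hA2).2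
  have cB := (Finset.mem_filter.mp hB2).2
  have hA0 : (A : Finset (Sym2 V)) ∉ oddFamily G 0 := fun h => by
    have := (Finset.mem_filter.mp h).2
    omega
  have hB0 : (B : Finset (Sym2 V)) ∉ oddFamily G 0 := fun h => by
    have := (Finset.mem_filter.mp h).2
    omega
  have hv : v ∉ boundary (A : Finset (Sym2 V)) := by
    intro hv
    have hpair : ({u, v} : Finset V) = boundary (A : Finset (Sym2 V)) := by
      apply Finset.eq_of_subset_of_card_le
      · intro w hw
        rcases Finset.mem_insert.mp hw with rfl | hw
        · exact hu
        · rwa [Finset.mem_singleton.mp hw]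
      · rw [cA, Finset.card_pair huv.ne]
    have : boundary (B : Finset (Sym2 V)) = ∅ := by
      ext w
      rw [hB, boundary_flip _ huv.ne, ← hpair]
      simp
    simp [this] at cB
  rw [transitionMatrix_flip x huv hB]
  simp only [flipProbability, if_neg hA0, if_neg hB0, if_pos hu, if_neg hv, add_zero]

/-- The rows of the transition matrix sum to one. -/
theorem transitionMatrix_row_sum (x : ℝ) (A : State G) : ∑ B, transitionMatrix G x A B = 1 := by
  rw [← Finset.add_sum_erase _ _ (Finset.mem_univ A)]
  have h : ∑ B ∈ Finset.univ.erase A, transitionMatrix G x A B =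
      ∑ B ∈ Finset.univ.erase A, moveProbability G x A B :=
    Finset.sum_congr rfl fun B hB => by
      rw [transitionMatrix, if_neg (Finset.ne_of_mem_erase hB).symm]
  rw [h, transitionMatrix, if_pos rfl]
  ring

end Explicit

/-- `X` is a Markov chain with transition matrix `P` started in the state `s₀`, on the
probability space `(Ω, μ)`, with a discrete state space `S`. -/
structure IsMarkovChain {S : Type u} {Ω : Type v} [MeasurableSpace Ω] (P : Matrix S S ℝ) (s₀ : S)
    (μ : Measure Ω) (X : ℕ → Ω → S) : Prop where
  measurable : ∀ t s, MeasurableSet (X t ⁻¹' {s})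
  initial : ∀ᵐ ω ∂μ, X 0 ω = s₀
  step : ∀ (t : ℕ) (a : ℕ → S),
    μ.real {ω | ∀ r ≤ t + 1, X r ω = a r} =
      μ.real {ω | ∀ r ≤ t, X r ω = a r} * P (a t) (a (t + 1))

/-- The sample mean `(1/N) ∑_{t=τ+1}^{τ+N} f(X_t)`. -/
def sampleMean {S : Type u} {Ω : Type v} (X : ℕ → Ω → S) (f : S → ℝ) (τ N : ℕ) (ω : Ω) : ℝ :=
  1 / (N : ℝ) * ∑ t ∈ Finset.Icc (τ + 1) (τ + N), f (X t ω)

/-- The random variable `Y` provides an `(ε, δ)`-approximation of `y`. -/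
def IsApproximation {Ω : Type v} [MeasurableSpace Ω] (μ : Measure Ω) (Y : Ω → ℝ)
    (y ε δ : ℝ) : Prop :=
  1 - δ ≤ μ.real {ω | |Y ω - y| ≤ ε * y}

section Sizes

variable {V : Type u} [Fintype V] [DecidableEq V] (G : SimpleGraph V) [DecidableRel G.Adj]

/-- The burn-in time `τ`, with `n = |V|`, `m = |E|` and maximum degree `Δ`. -/
def burnIn (δ : ℝ) : ℕ :=
  ⌈4 * (Real.log 2 + Real.log (2 * δ⁻¹) / G.edgeFinset.card) * G.maxDegree *
    (G.edgeFinset.card : ℝ) ^ 2 * (Fintype.card V : ℝ) ^ 4⌉₊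

/-- The least sample size. The norm of `f` is the supremum norm. -/
def sampleSize (x : ℝ) (f : State G → ℝ) (ε δ : ℝ) : ℕ :=
  ⌈16 * (ε ^ 2)⁻¹ * δ⁻¹ * G.maxDegree * G.edgeFinset.card * (Fintype.card V : ℝ) ^ 4 *
    (‖f‖ / psExpectation G x f)⌉₊

end Sizes

end

end Worm

/-! The worm process is lazy and reversible, so its matrix is a positive self-adjoint operator on
L²(π). A Poincaré inequality with constant T makes it contract mean-zero functions by 1 - 1/T
(`mean_sq_iterate_le`). At stationarity the centred sum of N samples then has second moment at most
2TN times the variance, and Chebyshev bounds the deviation probability by δ/2. Started from ∅, that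
probability is the τ-th iterate of P applied to the function giving the deviation probability from
each state. Its distance to the stationary mean is at most (1 - 1/T)^τ / √π(∅). Since π(∅) ≥ 2^(-m),
the burn-in time makes this at most δ/2 (`measureReal_deviation_le`, `decay_burnIn`).

The Poincaré inequality (`poincare`) comes from canonical paths. The variance is at most the second
moment about the weighted average over C_0, so by convexity only pairs (I, F) with F in C_0 need
paths. With I = F ∆ D, the path removes the edges of D one at a time without leaving W. If it passes
through the neighbouring pair (A, A') and U = A ∪ A', then |I| + |F| = |D ∆ U| + |U|, and D together
with (A, A') determines the step. The congestion of the pair is thus controlled by ∑_D ψ(D) x^|D ∆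
U|. By the high-temperature expansion of the Ising model, each class of edge sets with prescribed
boundary weighs at most as much as C_0, so the sum is at most n² times the weight of C_0. Together
with a lower bound of order 1/Δ on the flow through an edge flip, this gives the constant 4Δmn²,
which is weaker still when replaced by T = 4Δmn⁴. -/

namespace Worm

/-! ### Contraction of mean-zero functions by lazy reversible chains -/

section ReversibleChains

variable {S : Type u} [Fintype S]

/-- The expectation of `f` with respect to the weights `π`. -/
def mean (π f : S → ℝ) : ℝ := ∑ a, π a * f a

theorem mean_add (π f g : S → ℝ) : mean π (f + g) = mean π f + mean π g := by
  simp [mean, mul_add, Finset.sum_add_distrib]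

theorem mean_sub (π f g : S → ℝ) : mean π (f - g) = mean π f - mean π g := by
  simp [mean, mul_sub, Finset.sum_sub_distrib]

theorem mean_smul (π f : S → ℝ) (c : ℝ) : mean π (c • f) = c * mean π f := by
  simp only [mean, Finset.mul_sum, Pi.smul_apply, smul_eq_mul]
  exact Finset.sum_congr rfl fun a _ => by ring

theorem mean_mono {π f g : S → ℝ} (hπ : ∀ a, 0 ≤ π a) (h : ∀ a, f a ≤ g a) :
    mean π f ≤ mean π g :=
  Finset.sum_le_sum fun a _ => mul_le_mul_of_nonneg_left (h a) (hπ a)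

/-- `P` is a lazy stochastic matrix, reversible with respect to the positive probability
vector `π`. -/
structure IsLazyReversible [DecidableEq S] (P : Matrix S S ℝ) (π : S → ℝ) : Prop where
  pos : ∀ a, 0 < π a
  sum_one : ∑ a, π a = 1
  nonneg : ∀ a b, 0 ≤ P a b
  row_sum : ∀ a, ∑ b, P a b = 1
  reversible : ∀ a b, π a * P a b = π b * P b a
  lazy : ∀ a, 1 / 2 ≤ P a a

namespace IsLazyReversible

variable [DecidableEq S] {P : Matrix S S ℝ} {π : S → ℝ} (h : IsLazyReversible P π)

include h

theorem mean_const (c : ℝ) : mean π (fun _ => c) = c := by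
  rw [mean, ← Finset.sum_mul, h.sum_one, one_mul]

theorem mean_mul_mulVec_comm (f g : S → ℝ) :
    mean π (f * P.mulVec g) = mean π (P.mulVec f * g) := by
  simp only [mean, Matrix.mulVec, dotProduct, Pi.mul_apply, Finset.mul_sum, Finset.sum_mul]
  rw [Finset.sum_comm]
  refine Finset.sum_congr rfl fun a _ => Finset.sum_congr rfl fun b _ => ?_
  linear_combination (f b * g a) * h.reversible b a

theorem mulVec_const (c : ℝ) : P.mulVec (fun _ => c) = fun _ => c := by
  ext a
  simp [Matrix.mulVec, dotProduct, ← Finset.sum_mul, h.row_sum]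

theorem mean_mulVec (f : S → ℝ) : mean π (P.mulVec f) = mean π f := by
  have := h.mean_mul_mulVec_comm (fun _ => 1) f
  rw [h.mulVec_const] at this
  simpa [mean] using this

theorem sum_sum_flow_left (f : S → ℝ) :
    ∑ a, ∑ b, π a * P a b * f a = mean π f := by
  refine Finset.sum_congr rfl fun a _ => ?_
  rw [← Finset.sum_mul, ← Finset.mul_sum, h.row_sum, mul_one]

theorem sum_sum_flow_right (f : S → ℝ) :
    ∑ a, ∑ b, π a * P a b * f b = mean π f := by
  rw [Finset.sum_comm, ← h.sum_sum_flow_left]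
  exact Finset.sum_congr rfl fun a _ => Finset.sum_congr rfl fun b _ => by rw [h.reversible]

omit h [DecidableEq S] in
theorem sum_sum_flow_mul (f : S → ℝ) :
    ∑ a, ∑ b, π a * P a b * (f a * f b) = mean π (f * P.mulVec f) := by
  simp only [mean, Matrix.mulVec, dotProduct, Pi.mul_apply, Finset.mul_sum]
  exact Finset.sum_congr rfl fun a _ => Finset.sum_congr rfl fun b _ => by ring

theorem dirichlet_eq (f : S → ℝ) :
    ∑ a, ∑ b, π a * P a b * (f a - f b) ^ 2 =
      2 * (mean π (f * f) - mean π (f * P.mulVec f)) := by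
  have e : ∀ a b, π a * P a b * (f a - f b) ^ 2 =
      π a * P a b * ((f * f) a) + π a * P a b * ((f * f) b) - 2 * (π a * P a b * (f a * f b)) :=
    fun a b => by simp only [Pi.mul_apply]; ring
  simp only [e, Finset.sum_sub_distrib, Finset.sum_add_distrib, ← Finset.mul_sum]
  rw [h.sum_sum_flow_left, h.sum_sum_flow_right, sum_sum_flow_mul]
  ring

/-- Laziness rules out negative spectrum: in the quadratic form with (f a + f b)², the diagonal
terms alone contribute 4 P(a,a) f(a)² ≥ 2 f(a)². -/
theorem mean_mul_mulVec_nonneg (f : S → ℝ) : 0 ≤ mean π (f * P.mulVec f) := by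
  have e : ∀ a b, π a * P a b * (f a + f b) ^ 2 =
      π a * P a b * ((f * f) a) + π a * P a b * ((f * f) b) + 2 * (π a * P a b * (f a * f b)) :=
    fun a b => by simp only [Pi.mul_apply]; ring
  have h1 : ∑ a, ∑ b, π a * P a b * (f a + f b) ^ 2 =
      2 * (mean π (f * f) + mean π (f * P.mulVec f)) := by
    simp only [e, Finset.sum_add_distrib, ← Finset.mul_sum]
    rw [h.sum_sum_flow_left, h.sum_sum_flow_right, sum_sum_flow_mul]
    ring
  have h2 : 2 * mean π (f * f) ≤ ∑ a, ∑ b, π a * P a b * (f a + f b) ^ 2 := by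
    rw [mean, Finset.mul_sum]
    refine Finset.sum_le_sum fun a _ => ?_
    refine le_trans ?_ (Finset.single_le_sum (f := fun b => π a * P a b * (f a + f b) ^ 2)
      (fun b _ => mul_nonneg (mul_nonneg (h.pos a).le (h.nonneg a b)) (sq_nonneg _))
      (Finset.mem_univ a))
    have h3 := mul_le_mul_of_nonneg_left (h.lazy a) (mul_nonneg (h.pos a).le (sq_nonneg (f a)))
    simp only [Pi.mul_apply]
    nlinarith
  linarith

/-- This replaces the spectral theorem. Positivity of P is applied to (P - l)g, and the gap
hypothesis bounds the two outer terms of the expansion ⟨Pg, P²g⟩ - 2l⟨Pg, Pg⟩ + l²⟨g, Pg⟩ ≥ 0. -/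
theorem mean_sq_mulVec_le {l : ℝ} (hl : 0 < l)
    (gap : ∀ f, mean π f = 0 → mean π (f * P.mulVec f) ≤ l * mean π (f * f))
    {g : S → ℝ} (hg : mean π g = 0) :
    mean π (P.mulVec g * P.mulVec g) ≤ l ^ 2 * mean π (g * g) := by
  have h1 := h.mean_mul_mulVec_nonneg (P.mulVec g - l • g)
  have h2 := gap g hg
  have h3 := gap (P.mulVec g) (by rw [h.mean_mulVec, hg])
  have h4 : mean π ((P.mulVec g - l • g) * P.mulVec (P.mulVec g - l • g)) =
      mean π (P.mulVec g * P.mulVec (P.mulVec g)) - 2 * l * mean π (P.mulVec g * P.mulVec g) +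
        l ^ 2 * mean π (g * P.mulVec g) := by
    have e : (P.mulVec g - l • g) * P.mulVec (P.mulVec g - l • g) =
        P.mulVec g * P.mulVec (P.mulVec g) - l • (P.mulVec g * P.mulVec g) -
          l • (g * P.mulVec (P.mulVec g)) + (l ^ 2) • (g * P.mulVec g) := by
      rw [Matrix.mulVec_sub, Matrix.mulVec_smul]
      ext a
      simp only [Pi.mul_apply, Pi.sub_apply, Pi.smul_apply, Pi.add_apply, smul_eq_mul]
      ring
    rw [e, mean_add, mean_sub, mean_sub, mean_smul, mean_smul, mean_smul,
      h.mean_mul_mulVec_comm g (P.mulVec g)]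
    ring
  have h5 : l * mean π (P.mulVec g * P.mulVec g) ≤ l * (l ^ 2 * mean π (g * g)) := by
    nlinarith [mul_le_mul_of_nonneg_left h2 (sq_nonneg l)]
  exact le_of_mul_le_mul_left h5 hl

theorem mean_iterate_mulVec (g : S → ℝ) (k : ℕ) : mean π (P.mulVec^[k] g) = mean π g := by
  induction k with
  | zero => rfl
  | succ k ih => rw [Function.iterate_succ_apply', h.mean_mulVec, ih]

theorem mean_sq_iterate_le {l : ℝ} (hl : 0 < l)
    (gap : ∀ f, mean π f = 0 → mean π (f * P.mulVec f) ≤ l * mean π (f * f))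
    {g : S → ℝ} (hg : mean π g = 0) (k : ℕ) :
    mean π (P.mulVec^[k] g * P.mulVec^[k] g) ≤ (l ^ k) ^ 2 * mean π (g * g) := by
  induction k with
  | zero => simp
  | succ k ih =>
    rw [Function.iterate_succ_apply']
    refine (h.mean_sq_mulVec_le hl gap (by rw [h.mean_iterate_mulVec, hg])).trans ?_
    calc _ ≤ l ^ 2 * ((l ^ k) ^ 2 * mean π (g * g)) :=
          mul_le_mul_of_nonneg_left ih (sq_nonneg l)
      _ = _ := by ring

/-- Cauchy–Schwarz, in the form of the nonnegative square of P^k g - l^k g. It bounds the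
autocovariances at stationarity. -/
theorem mean_mul_iterate_le {l : ℝ} (hl : 0 < l)
    (gap : ∀ f, mean π f = 0 → mean π (f * P.mulVec f) ≤ l * mean π (f * f))
    {g : S → ℝ} (hg : mean π g = 0) (k : ℕ) :
    mean π (g * P.mulVec^[k] g) ≤ l ^ k * mean π (g * g) := by
  have h1 := h.mean_sq_iterate_le hl gap hg k
  have h2 : 0 ≤ mean π ((P.mulVec^[k] g - l ^ k • g) * (P.mulVec^[k] g - l ^ k • g)) :=
    Finset.sum_nonneg fun a _ => mul_nonneg (h.pos a).le (mul_self_nonneg _)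
  have e : (P.mulVec^[k] g - l ^ k • g) * (P.mulVec^[k] g - l ^ k • g) =
      P.mulVec^[k] g * P.mulVec^[k] g - (2 * l ^ k) • (g * P.mulVec^[k] g) +
        ((l ^ k) ^ 2) • (g * g) := by
    ext a
    simp only [Pi.mul_apply, Pi.sub_apply, Pi.smul_apply, Pi.add_apply, smul_eq_mul]
    ring
  rw [e, mean_add, mean_sub, mean_smul, mean_smul] at h2
  have hk : 0 < l ^ k := pow_pos hl k
  have h3 : l ^ k * mean π (g * P.mulVec^[k] g) ≤ l ^ k * (l ^ k * mean π (g * g)) := by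
    nlinarith
  exact le_of_mul_le_mul_left h3 hk

/-- A single point carries at most the whole squared L²(π) norm; this is where the factor π a
enters. The variance of a function with values in [0, 1] is at most 1. -/
theorem abs_iterate_sub_mean_le {l : ℝ} (hl : 0 < l)
    (gap : ∀ f, mean π f = 0 → mean π (f * P.mulVec f) ≤ l * mean π (f * f))
    {V : S → ℝ} (h0 : ∀ a, 0 ≤ V a) (h1 : ∀ a, V a ≤ 1) (a : S) (k : ℕ) :
    π a * (P.mulVec^[k] V a - mean π V) ^ 2 ≤ (l ^ k) ^ 2 := by
  set g : S → ℝ := V - fun _ => mean π V with hg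
  have hg0 : mean π g = 0 := by rw [hg, mean_sub, h.mean_const, sub_self]
  have hit : ∀ k, P.mulVec^[k] g = P.mulVec^[k] V - fun _ => mean π V := by
    intro k
    induction k with
    | zero => rfl
    | succ k ih =>
      rw [Function.iterate_succ_apply', ih, Matrix.mulVec_sub, h.mulVec_const,
        Function.iterate_succ_apply']
  have h2 := h.mean_sq_iterate_le hl gap hg0 k
  have h3 : π a * (P.mulVec^[k] V a - mean π V) ^ 2 ≤
      mean π (P.mulVec^[k] g * P.mulVec^[k] g) := by
    refine le_trans (le_of_eq ?_) (Finset.single_le_sum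
      (f := fun a => π a * (P.mulVec^[k] g * P.mulVec^[k] g) a)
      (fun b _ => mul_nonneg (h.pos b).le (mul_self_nonneg _)) (Finset.mem_univ a))
    simp only [hit, Pi.mul_apply, Pi.sub_apply]
    ring
  have h4 : mean π (g * g) ≤ 1 := by
    have e : g * g = V * V - (2 * mean π V) • V + fun _ => mean π V ^ 2 := by
      ext a
      simp only [hg, Pi.mul_apply, Pi.sub_apply, Pi.smul_apply, Pi.add_apply, smul_eq_mul]
      ring
    rw [e, mean_add, mean_sub, mean_smul, h.mean_const]
    have h5 : mean π (V * V) ≤ mean π (fun _ => (1 : ℝ)) :=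
      mean_mono (fun a => (h.pos a).le) fun a => by
        simp only [Pi.mul_apply]
        nlinarith [h0 a, h1 a]
    rw [h.mean_const] at h5
    nlinarith [sq_nonneg (mean π V)]
  nlinarith [sq_nonneg (l ^ k)]

end IsLazyReversible

/-! ### Moments and tails of additive functionals -/

/-- The probability that a chain started at `a` satisfies `c ≤ |s + g(X_1) + ⋯ + g(X_k)|`. -/
noncomputable def tailProb (P : Matrix S S ℝ) (g : S → ℝ) (c : ℝ) : ℕ → ℝ → S → ℝ
  | 0, s, _ => if c ≤ |s| then 1 else 0
  | k + 1, s, a => ∑ b, P a b * tailProb P g c k (s + g b) b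

/-- The expectation of `g(X_1) + ⋯ + g(X_k)`, as a function of the starting point. -/
def firstMoment (P : Matrix S S ℝ) (g : S → ℝ) : ℕ → S → ℝ
  | 0 => 0
  | k + 1 => P.mulVec (g + firstMoment P g k)

/-- The expectation of `(g(X_1) + ⋯ + g(X_k)) ^ 2`, as a function of the starting point. -/
def secondMoment (P : Matrix S S ℝ) (g : S → ℝ) : ℕ → S → ℝ
  | 0 => 0
  | k + 1 => P.mulVec (g * g + (2 : ℝ) • (g * firstMoment P g k) + secondMoment P g k)

namespace IsLazyReversible

variable [DecidableEq S] {P : Matrix S S ℝ} {π : S → ℝ} (h : IsLazyReversible P π)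

include h

theorem tailProb_nonneg (g : S → ℝ) (c : ℝ) (k : ℕ) (s : ℝ) (a : S) :
    0 ≤ tailProb P g c k s a := by
  induction k generalizing s a with
  | zero => rw [tailProb]; split_ifs <;> norm_num
  | succ k ih => exact Finset.sum_nonneg fun b _ => mul_nonneg (h.nonneg a b) (ih _ _)

theorem tailProb_le_one (g : S → ℝ) (c : ℝ) (k : ℕ) (s : ℝ) (a : S) :
    tailProb P g c k s a ≤ 1 := by
  induction k generalizing s a with
  | zero => rw [tailProb]; split_ifs <;> norm_num
  | succ k ih =>
    rw [tailProb, ← h.row_sum a]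
    exact Finset.sum_le_sum fun b _ => mul_le_of_le_one_right (h.nonneg a b) (ih _ _)

/-- Chebyshev's inequality: the right side is the expectation of (s + g(X_1) + ⋯ + g(X_k))².
Carrying the accumulated value s makes the induction on the number of steps close. -/
theorem sq_mul_tailProb_le (g : S → ℝ) {c : ℝ} (hc : 0 ≤ c) (k : ℕ) (s : ℝ) (a : S) :
    c ^ 2 * tailProb P g c k s a ≤
      s ^ 2 + 2 * s * firstMoment P g k a + secondMoment P g k a := by
  induction k generalizing s a with
  | zero =>
    simp only [tailProb, firstMoment, secondMoment, Pi.zero_apply]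
    split_ifs with hs
    · have := pow_le_pow_left₀ hc hs 2
      rw [sq_abs] at this
      linarith
    · nlinarith [sq_nonneg s]
  | succ k ih =>
    have e : s ^ 2 + 2 * s * firstMoment P g (k + 1) a + secondMoment P g (k + 1) a =
        ∑ b, P a b * ((s + g b) ^ 2 + 2 * (s + g b) * firstMoment P g k b +
          secondMoment P g k b) := by
      have e1 : s ^ 2 = ∑ b, P a b * s ^ 2 := by rw [← Finset.sum_mul, h.row_sum, one_mul]
      rw [e1]
      simp only [firstMoment, secondMoment, Matrix.mulVec, dotProduct, Finset.mul_sum,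
        ← Finset.sum_add_distrib, Pi.add_apply, Pi.mul_apply, Pi.smul_apply, smul_eq_mul]
      exact Finset.sum_congr rfl fun b _ => by ring
    rw [e, tailProb, Finset.mul_sum]
    refine Finset.sum_le_sum fun b _ => ?_
    have := mul_le_mul_of_nonneg_left (ih (s + g b) b) (h.nonneg a b)
    linarith

omit h [DecidableEq S] in
theorem firstMoment_eq_sum (g : S → ℝ) (k : ℕ) :
    firstMoment P g k = ∑ j ∈ Finset.range k, P.mulVec^[j + 1] g := by
  induction k with
  | zero => rfl
  | succ k ih =>
    rw [firstMoment, ih, Matrix.mulVec_add, Finset.sum_range_succ', add_comm]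
    congr 1
    rw [← Matrix.mulVecLin_apply, map_sum]
    exact Finset.sum_congr rfl fun j _ => (Function.iterate_succ_apply' _ _ _).symm

/-- By stationarity each extra sample adds ⟨g, g⟩ plus twice the sum of its covariances with the
later samples, which is dominated by a geometric series. -/
theorem mean_secondMoment_le {l : ℝ} (hl : 0 < l) (hl1 : l < 1)
    (gap : ∀ f, mean π f = 0 → mean π (f * P.mulVec f) ≤ l * mean π (f * f))
    {g : S → ℝ} (hg : mean π g = 0) (k : ℕ) :
    mean π (secondMoment P g k) ≤ 2 / (1 - l) * k * mean π (g * g) := by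
  have hgg : 0 ≤ mean π (g * g) :=
    Finset.sum_nonneg fun a _ => mul_nonneg (h.pos a).le (mul_self_nonneg _)
  induction k with
  | zero => simp [secondMoment, mean]
  | succ k ih =>
    rw [secondMoment, h.mean_mulVec, mean_add, mean_add, mean_smul]
    have h1 : mean π (g * firstMoment P g k) ≤ l / (1 - l) * mean π (g * g) := by
      have e : mean π (g * firstMoment P g k) =
          ∑ j ∈ Finset.range k, mean π (g * P.mulVec^[j + 1] g) := by
        rw [firstMoment_eq_sum]
        simp only [mean, Pi.mul_apply, Finset.sum_apply, Finset.mul_sum]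
        rw [Finset.sum_comm]
      rw [e]
      calc _ ≤ ∑ j ∈ Finset.range k, l ^ (j + 1) * mean π (g * g) :=
            Finset.sum_le_sum fun j _ => h.mean_mul_iterate_le hl gap hg (j + 1)
        _ = l * (∑ j ∈ Finset.range k, l ^ j) * mean π (g * g) := by
            rw [← Finset.sum_mul, Finset.mul_sum]
            simp only [pow_succ']
        _ ≤ _ := by
            refine mul_le_mul_of_nonneg_right ?_ hgg
            rw [div_eq_mul_inv]
            refine mul_le_mul_of_nonneg_left ?_ hl.le
            rw [← tsum_geometric_of_lt_one hl.le hl1]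
            exact (summable_geometric_of_lt_one hl.le hl1).sum_le_tsum _
              fun j _ => pow_nonneg hl.le j
    -- The left side equals (1 + l)/(1 - l), so the two sides differ by exactly 1.
    have h2 : 1 + 2 * (l / (1 - l)) ≤ 2 / (1 - l) := by
      have : 0 < 1 - l := by linarith
      rw [← sub_nonneg]
      have e : 2 / (1 - l) - (1 + 2 * (l / (1 - l))) = 1 := by field_simp; ring
      rw [e]; norm_num
    have h3 := mul_le_mul_of_nonneg_right h2 hgg
    push_cast
    nlinarith

end IsLazyReversible

end ReversibleChains

/-! ### From path probabilities to iterates of the transition matrix -/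

section MarkovChains

variable {S : Type u} [Fintype S] {Ω : Type v} [MeasurableSpace Ω] {μ : Measure Ω}
  {P : Matrix S S ℝ} {s₀ : S} {X : ℕ → Ω → S}

theorem measureReal_eq_sum_inter_preimage [IsFiniteMeasure μ] {Y : Ω → S}
    (hY : ∀ s, MeasurableSet (Y ⁻¹' {s})) (H : Set Ω) :
    μ.real H = ∑ b, μ.real (Y ⁻¹' {b} ∩ H) := by
  have h1 := sum_measure_preimage_singleton (μ := μ.restrict H) (f := Y) Finset.univ
    fun y _ => hY y
  simp only [Measure.restrict_apply (hY _), Finset.coe_univ, Set.preimage_univ,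
    Measure.restrict_apply_univ] at h1
  rw [measureReal_def, ← h1, ENNReal.toReal_sum fun b _ => measure_ne_top _ _]
  rfl

/-- One step of conditioning on the past of a Markov chain. -/
theorem IsMarkovChain.measureReal_past_inter [IsFiniteMeasure μ]
    (hX : IsMarkovChain P s₀ μ X) {t : ℕ} {H : Set Ω} {w : S → ℝ}
    (hw : ∀ a : ℕ → S, μ.real ({ω | ∀ r ≤ t + 1, X r ω = a r} ∩ H) =
      μ.real {ω | ∀ r ≤ t + 1, X r ω = a r} * w (a (t + 1))) (a : ℕ → S) :
    μ.real ({ω | ∀ r ≤ t, X r ω = a r} ∩ H) =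
      μ.real {ω | ∀ r ≤ t, X r ω = a r} * P.mulVec w (a t) := by
  classical
  rw [measureReal_eq_sum_inter_preimage (hX.measurable (t + 1)), Matrix.mulVec, dotProduct,
    Finset.mul_sum]
  refine Finset.sum_congr rfl fun b _ => ?_
  -- The hypothesis `hw` covers all prescribed paths, hence also the path altered at time t + 1 to
  -- visit b.
  set a' := Function.update a (t + 1) b with ha'
  have h1 : ∀ r ≤ t, a' r = a r := fun r hr => Function.update_of_ne (by omega) _ _
  have h2 : a' (t + 1) = b := Function.update_self _ _ _
  have h3 : X (t + 1) ⁻¹' {b} ∩ ({ω | ∀ r ≤ t, X r ω = a r} ∩ H) =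
      {ω | ∀ r ≤ t + 1, X r ω = a' r} ∩ H := by
    ext ω
    simp only [Set.mem_inter_iff, Set.mem_preimage, Set.mem_singleton_iff, Set.mem_ofPred_eq]
    constructor
    · rintro ⟨hb, hr, hH⟩
      refine ⟨fun r hrt => ?_, hH⟩
      rcases Nat.le_succ_iff.mp hrt with hrt | rfl
      · rw [h1 r hrt, hr r hrt]
      · rw [h2, hb]
    · rintro ⟨hr, hH⟩
      exact ⟨by rw [hr _ le_rfl, h2], fun r hrt => by rw [hr r (by omega), h1 r hrt], hH⟩
  have h4 : {ω | ∀ r ≤ t, X r ω = a' r} = {ω | ∀ r ≤ t, X r ω = a r} := by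
    ext ω
    exact forall₂_congr fun r hr => by rw [h1 r hr]
  rw [h3, hw, hX.step, h4, h2, h1 t le_rfl]
  ring

/-- Conditioning on one more step moves the summand g(X_{t+1}) into the accumulated value s, which
is why s and t vary in the induction. -/
theorem IsMarkovChain.measureReal_past_inter_tail [IsFiniteMeasure μ]
    (hX : IsMarkovChain P s₀ μ X) (g : S → ℝ) (c : ℝ) (k t : ℕ) (s : ℝ) (a : ℕ → S) :
    μ.real ({ω | ∀ r ≤ t, X r ω = a r} ∩
      {ω | c ≤ |s + ∑ i ∈ Finset.Icc (t + 1) (t + k), g (X i ω)|}) =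
      μ.real {ω | ∀ r ≤ t, X r ω = a r} * tailProb P g c k s (a t) := by
  induction k generalizing t s a with
  | zero =>
    simp only [add_zero, tailProb, Nat.lt_succ_self, Finset.Icc_eq_empty_of_lt,
      Finset.sum_empty]
    split_ifs with hs <;> simp [hs]
  | succ k ih =>
    refine hX.measureReal_past_inter (w := fun b => tailProb P g c k (s + g b) b)
      (fun a => ?_) a
    rw [← ih]
    congr 1
    ext ω
    simp only [Set.mem_inter_iff, Set.mem_ofPred_eq]
    refine and_congr_right fun hr => ?_
    rw [← hr _ le_rfl, show t + (k + 1) = t + 1 + k by ring,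
      ← Finset.insert_Icc_add_one_left_eq_Icc (show t + 1 ≤ t + 1 + k by omega),
      Finset.sum_insert (by simp), ← add_assoc s]

theorem IsMarkovChain.measureReal_tail [IsProbabilityMeasure μ]
    (hX : IsMarkovChain P s₀ μ X) (g : S → ℝ) (c : ℝ) (k τ : ℕ) :
    μ.real {ω | c ≤ |∑ i ∈ Finset.Icc (τ + 1) (τ + k), g (X i ω)|} =
      P.mulVec^[τ] (tailProb P g c k 0) s₀ := by
  set H := {ω | c ≤ |∑ i ∈ Finset.Icc (τ + 1) (τ + k), g (X i ω)|} with hH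
  -- Backward induction from time τ: j counts the burn-in steps still to be averaged over.
  have key : ∀ j t, t + j = τ → ∀ a : ℕ → S, μ.real ({ω | ∀ r ≤ t, X r ω = a r} ∩ H) =
      μ.real {ω | ∀ r ≤ t, X r ω = a r} * P.mulVec^[j] (tailProb P g c k 0) (a t) := by
    intro j
    induction j with
    | zero =>
      rintro t rfl a
      rw [Function.iterate_zero, id, ← hX.measureReal_past_inter_tail]
      simp only [zero_add, hH, add_zero]
    | succ j ih =>
      intro t ht a
      rw [Function.iterate_succ_apply']
      exact hX.measureReal_past_inter (ih (t + 1) (by omega)) a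
  have h0 := key τ 0 (zero_add _) fun _ => s₀
  have h1 : ∀ᵐ ω ∂μ, ω ∈ {ω | ∀ r ≤ 0, X r ω = s₀} := by
    filter_upwards [hX.initial] with ω hω
    simpa using hω
  have h2 : μ.real {ω | ∀ r ≤ 0, X r ω = s₀} = 1 := by
    have h3 : {ω | ∀ r ≤ 0, X r ω = s₀} =ᵐ[μ] Set.univ := Filter.eventuallyEq_univ.mpr h1
    rw [measureReal_def, measure_congr h3]
    simp
  rw [h2, one_mul] at h0
  rw [← h0, measureReal_def, measureReal_def]
  congr 1
  refine measure_congr ?_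
  filter_upwards [h1] with ω hω
  exact propext ⟨fun h => ⟨hω, h⟩, fun h => h.2⟩

end MarkovChains

/-! ### Parity of boundaries and the high-temperature expansion -/

section Boundaries

theorem card_symmDiff_add_card {α : Type u} [DecidableEq α] (A D : Finset α) :
    (symmDiff A D).card + A.card = 2 * (A \ D).card + D.card := by
  have h1 : (symmDiff A D).card = (A \ D).card + (D \ A).card :=
    Finset.card_union_of_disjoint disjoint_sdiff_sdiff
  have h2 := Finset.card_sdiff_add_card_inter A D
  have h3 := Finset.card_sdiff_add_card_inter D A
  rw [Finset.inter_comm] at h3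
  omega

theorem odd_card_symmDiff {α : Type u} [DecidableEq α] (A D : Finset α) :
    Odd (symmDiff A D).card ↔ ¬ (Odd A.card ↔ Odd D.card) := by
  have := card_symmDiff_add_card A D
  simp only [Nat.odd_iff]
  omega

variable {V : Type u} [Fintype V] [DecidableEq V]

theorem boundary_symmDiff (A B : Finset (Sym2 V)) :
    boundary (symmDiff A B) = symmDiff (boundary A) (boundary B) := by
  ext v
  have h : degreeIn (symmDiff A B) v =
      (symmDiff (Finset.univ.filter fun u => s(u, v) ∈ A)
        (Finset.univ.filter fun u => s(u, v) ∈ B)).card := by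
    unfold degreeIn
    congr 1
    ext u
    simp [Finset.mem_symmDiff]
  simp only [boundary, Finset.mem_symmDiff, Finset.mem_filter, Finset.mem_univ, true_and, h,
    odd_card_symmDiff]
  simp only [degreeIn]
  tauto

theorem boundary_empty : boundary (∅ : Finset (Sym2 V)) = ∅ := by
  simp [boundary, degreeIn]

theorem boundary_singleton {a b : V} (hab : a ≠ b) : boundary {s(a, b)} = {a, b} := by
  ext w
  have := boundary_flip ∅ hab w
  rw [boundary_empty, ← Finset.bot_eq_empty, bot_symmDiff] at this
  rw [this, Finset.mem_insert, Finset.mem_singleton]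
  simp only [Finset.notMem_empty]
  tauto

/-- The value of the product `∏_{v ∈ T} σ_v` of spins, where `σ = -1` exactly on `S`. -/
def spin (T S : Finset V) : ℝ := (-1) ^ (T ∩ S).card

-- The maps `spin T` are characters: |A ∆ D| + |A| and |D| have the same parity.
omit [Fintype V] in
theorem spin_symmDiff (T T' S : Finset V) : spin (symmDiff T T') S = spin T S * spin T' S := by
  have h : symmDiff T T' ∩ S = symmDiff (T ∩ S) (T' ∩ S) := by
    ext v
    simp only [Finset.mem_inter, Finset.mem_symmDiff]
    tauto
  have h1 := congrArg (fun n : ℕ => (-1 : ℝ) ^ n) (card_symmDiff_add_card (T ∩ S) (T' ∩ S))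
  simp only [pow_add, pow_mul, even_two, Even.neg_pow, one_pow, one_mul] at h1
  have h2 : ((-1 : ℝ) ^ (T ∩ S).card) * (-1) ^ (T ∩ S).card = 1 := by
    rw [← mul_pow]
    simp
  simp only [spin, h]
  linear_combination (-1 : ℝ) ^ (T ∩ S).card * h1 -
    (-1 : ℝ) ^ (symmDiff (T ∩ S) (T' ∩ S)).card * h2

omit [Fintype V] in
theorem abs_spin (T S : Finset V) : |spin T S| = 1 := by
  simp [spin, abs_pow]

/-- Flipping the spin at one vertex of T is a bijection that reverses the sign. -/
theorem sum_spin {T : Finset V} (hT : T ≠ ∅) : ∑ S, spin T S = 0 := by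
  obtain ⟨v, hv⟩ := Finset.nonempty_iff_ne_empty.mpr hT
  have hneg : ∀ S, spin T (symmDiff S {v}) = - spin T S := by
    intro S
    have hcomm : ∀ T S : Finset V, spin T S = spin S T := fun T S => by
      simp only [spin, Finset.inter_comm]
    rw [hcomm, spin_symmDiff, hcomm S, hcomm {v}]
    have : T ∩ {v} = {v} := by simpa using hv
    simp [spin, this]
  have h := Fintype.sum_equiv (Function.Involutive.toPerm (fun S : Finset V => symmDiff S {v})
    (fun S => symmDiff_symmDiff_cancel_right _ _)) (fun S => spin T (symmDiff S {v})) (spin T)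
    fun S => rfl
  simp only [hneg, Finset.sum_neg_distrib] at h
  linarith

/-- The sum of `x ^ |A|` over the subsets `A` of `E` with `∂A = T`. -/
def boundaryWeight (E : Finset (Sym2 V)) (x : ℝ) (T : Finset V) : ℝ :=
  ∑ A ∈ E.powerset.filter (fun A => boundary A = T), x ^ A.card

theorem prod_spin_boundary (A : Finset (Sym2 V)) (S : Finset V) :
    ∏ e ∈ A, spin (boundary {e}) S = spin (boundary A) S := by
  induction A using Finset.induction_on with
  | empty => simp [boundary_empty, spin]
  | insert e A he ih =>
    rw [Finset.prod_insert he, ih, ← spin_symmDiff, ← boundary_symmDiff]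
    congr 2
    rw [Finset.insert_eq]
    exact Disjoint.symmDiff_eq_sup (by simpa using he)

/-- High-temperature expansion: expanding the product over subsets A and summing over spins,
orthogonality of characters keeps exactly the A with boundary T. -/
theorem sum_spin_mul_prod (E : Finset (Sym2 V)) (x : ℝ) (T : Finset V) :
    ∑ S, spin T S * ∏ e ∈ E, (1 + x * spin (boundary {e}) S) =
      2 ^ Fintype.card V * boundaryWeight E x T := by
  have h1 : ∀ S, spin T S * ∏ e ∈ E, (1 + x * spin (boundary {e}) S) =
      ∑ A ∈ E.powerset, x ^ A.card * spin (symmDiff T (boundary A)) S := by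
    intro S
    rw [Finset.prod_one_add, Finset.mul_sum]
    refine Finset.sum_congr rfl fun A _ => ?_
    rw [Finset.prod_mul_distrib, prod_spin_boundary, Finset.prod_const, spin_symmDiff]
    ring
  simp only [h1]
  rw [Finset.sum_comm, boundaryWeight, Finset.sum_filter, Finset.mul_sum]
  refine Finset.sum_congr rfl fun A _ => ?_
  rw [← Finset.mul_sum]
  split_ifs with h
  · subst h
    simp [spin, mul_comm]
  · rw [sum_spin]
    · simp
    · intro h'
      exact h (symmDiff_eq_bot.mp h').symm

/-- Ising correlations of spins are at most one. -/
theorem boundaryWeight_le (E : Finset (Sym2 V)) {x : ℝ} (hx : 0 ≤ x) (hx1 : x ≤ 1)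
    (T : Finset V) : boundaryWeight E x T ≤ boundaryWeight E x ∅ := by
  have h : (2 : ℝ) ^ Fintype.card V * boundaryWeight E x T ≤
      2 ^ Fintype.card V * boundaryWeight E x ∅ := by
    rw [← sum_spin_mul_prod, ← sum_spin_mul_prod]
    -- The comparison is termwise: a spin product is at most 1, the value for T = ∅, and every
    -- factor 1 ± x is nonnegative because x ≤ 1.
    refine Finset.sum_le_sum fun S _ => mul_le_mul_of_nonneg_right ?_ ?_
    · have := le_abs_self (spin T S)
      rw [abs_spin] at this
      simpa [spin] using this
    · refine Finset.prod_nonneg fun e _ => ?_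
      have := neg_abs_le (spin (boundary {e}) S)
      rw [abs_spin] at this
      nlinarith
  exact le_of_mul_le_mul_left h (by positivity)

theorem sum_pow_card_symmDiff (E : Finset (Sym2 V)) (x : ℝ) (T : Finset V)
    {U : Finset (Sym2 V)} (hU : U ⊆ E) :
    ∑ D ∈ E.powerset.filter (fun D => boundary D = T), x ^ (symmDiff D U).card =
      boundaryWeight E x (symmDiff T (boundary U)) := by
  have hsub : ∀ D ⊆ E, symmDiff D U ⊆ E := fun D hD =>
    symmDiff_le_sup.trans (Finset.union_subset hD hU)
  refine Finset.sum_nbij' (fun D => symmDiff D U) (fun D => symmDiff D U) ?_ ?_ ?_ ?_ ?_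
  · intro D hD
    simp only [Finset.mem_filter, Finset.mem_powerset] at hD ⊢
    exact ⟨hsub D hD.1, by rw [boundary_symmDiff, hD.2]⟩
  · intro D hD
    simp only [Finset.mem_filter, Finset.mem_powerset] at hD ⊢
    exact ⟨hsub D hD.1, by rw [boundary_symmDiff, hD.2, symmDiff_symmDiff_cancel_right]⟩
  · exact fun D _ => symmDiff_symmDiff_cancel_right _ _
  · exact fun D _ => symmDiff_symmDiff_cancel_right _ _
  · exact fun D _ => rfl

end Boundaries

/-! ### Weights of translated configurations, and peeling off edges -/

section Configurations

variable {V : Type u} [Fintype V] [DecidableEq V] {G : SimpleGraph V} [DecidableRel G.Adj]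

theorem mem_oddFamily {k : ℕ} {A : Finset (Sym2 V)} :
    A ∈ oddFamily G k ↔ A ⊆ G.edgeFinset ∧ (boundary A).card = k := by
  simp [oddFamily]

theorem mem_oddFamily_zero {A : Finset (Sym2 V)} :
    A ∈ oddFamily G 0 ↔ A ⊆ G.edgeFinset ∧ boundary A = ∅ := by
  simp [oddFamily]

theorem mem_configurations {A : Finset (Sym2 V)} :
    A ∈ configurations G ↔
      A ⊆ G.edgeFinset ∧ ((boundary A).card = 0 ∨ (boundary A).card = 2) := by
  simp only [configurations, Finset.mem_union, mem_oddFamily]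
  tauto

theorem disjoint_oddFamily : Disjoint (oddFamily G 0) (oddFamily G 2) := by
  rw [Finset.disjoint_left]
  intro A h h'
  rw [mem_oddFamily] at h h'
  omega

theorem symmDiff_mem_configurations {F D : Finset (Sym2 V)} (hF : F ∈ oddFamily G 0)
    (hD : D ∈ configurations G) : symmDiff F D ∈ configurations G := by
  rw [mem_oddFamily_zero] at hF
  rw [mem_configurations] at hD ⊢
  refine ⟨symmDiff_le_sup.trans (Finset.union_subset hF.1 hD.1), ?_⟩
  rw [boundary_symmDiff, hF.2, ← Finset.bot_eq_empty, bot_symmDiff]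
  exact hD.2

theorem weight_oddFamily_zero (x : ℝ) :
    weight x (oddFamily G 0) = boundaryWeight G.edgeFinset x ∅ := by
  rw [weight, boundaryWeight]
  refine Finset.sum_congr ?_ fun _ _ => rfl
  ext A
  simp [mem_oddFamily_zero]

/-- The factor `ψ` on arbitrary edge sets. -/
def multiplicity (G : SimpleGraph V) [DecidableRel G.Adj] (A : Finset (Sym2 V)) : ℝ :=
  if A ∈ oddFamily G 0 then Fintype.card V else 2

theorem multiplicity_nonneg (A : Finset (Sym2 V)) : 0 ≤ multiplicity G A := by
  rw [multiplicity]
  split_ifs <;> positivity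

theorem multiplicity_symmDiff {F D : Finset (Sym2 V)} (hF : F ∈ oddFamily G 0)
    (hD : D ∈ configurations G) : multiplicity G (symmDiff F D) = multiplicity G D := by
  have h1 := (mem_configurations.mp (symmDiff_mem_configurations hF hD)).1
  have h2 := (mem_configurations.mp hD).1
  rw [mem_oddFamily_zero] at hF
  simp only [multiplicity, mem_oddFamily_zero, h1, h2, true_and]
  rw [boundary_symmDiff, hF.2, ← Finset.bot_eq_empty, bot_symmDiff]

/-- The total weight of all configurations translated by an edge set. -/
theorem sum_multiplicity_mul_pow_le {x : ℝ} (hx : 0 ≤ x) (hx1 : x ≤ 1)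
    {U : Finset (Sym2 V)} (hU : U ⊆ G.edgeFinset) :
    ∑ D ∈ configurations G, multiplicity G D * x ^ (symmDiff D U).card ≤
      (Fintype.card V : ℝ) ^ 2 * weight x (oddFamily G 0) := by
  rw [configurations, Finset.sum_union disjoint_oddFamily, weight_oddFamily_zero]
  have h0 : ∑ D ∈ oddFamily G 0, multiplicity G D * x ^ (symmDiff D U).card ≤
      Fintype.card V * boundaryWeight G.edgeFinset x ∅ := by
    have e : ∑ D ∈ oddFamily G 0, multiplicity G D * x ^ (symmDiff D U).card =
        Fintype.card V * ∑ D ∈ G.edgeFinset.powerset.filter (fun D => boundary D = ∅),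
          x ^ (symmDiff D U).card := by
      rw [Finset.mul_sum]
      refine Finset.sum_congr ?_ fun D hD => ?_
      · ext A
        simp [mem_oddFamily_zero]
      · rw [multiplicity, if_pos]
        simpa [mem_oddFamily_zero] using hD
    rw [e, sum_pow_card_symmDiff _ _ _ hU]
    exact mul_le_mul_of_nonneg_left (boundaryWeight_le _ hx hx1 _) (Nat.cast_nonneg _)
  have h2 : ∑ D ∈ oddFamily G 2, multiplicity G D * x ^ (symmDiff D U).card ≤
      2 * ((Fintype.card V).choose 2 * boundaryWeight G.edgeFinset x ∅) := by
    have e : ∑ D ∈ oddFamily G 2, multiplicity G D * x ^ (symmDiff D U).card =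
        2 * ∑ T ∈ Finset.univ.powersetCard 2, boundaryWeight G.edgeFinset x
          (symmDiff T (boundary U)) := by
      rw [← Finset.sum_fiberwise_of_maps_to (g := boundary)
        (t := Finset.univ.powersetCard 2), Finset.mul_sum]
      · refine Finset.sum_congr rfl fun T hT => ?_
        rw [← sum_pow_card_symmDiff _ _ _ hU, Finset.mul_sum]
        refine Finset.sum_congr ?_ fun D hD => ?_
        · ext A
          simp only [Finset.mem_filter, mem_oddFamily, Finset.mem_powerset]
          rw [Finset.mem_powersetCard] at hT
          constructor
          · rintro ⟨⟨h1, _⟩, h3⟩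
            exact ⟨h1, h3⟩
          · rintro ⟨h1, h3⟩
            exact ⟨⟨h1, by rw [h3, hT.2]⟩, h3⟩
        · rw [multiplicity, if_neg]
          simp only [Finset.mem_filter, Finset.mem_powerset] at hD
          rw [mem_oddFamily, hD.2, (Finset.mem_powersetCard.mp hT).2]
          simp
      · intro D hD
        rw [Finset.mem_powersetCard]
        exact ⟨Finset.subset_univ _, (mem_oddFamily.mp hD).2⟩
    rw [e]
    refine mul_le_mul_of_nonneg_left ?_ zero_le_two
    refine (Finset.sum_le_sum fun T _ => boundaryWeight_le _ hx hx1 _).trans (le_of_eq ?_)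
    rw [Finset.sum_const, Finset.card_powersetCard, Finset.card_univ, nsmul_eq_mul]
  -- There are `choose 2` possible two-point boundaries, each with ψ = 2; their n² - n and the n
  -- from C_0 add up to n².
  have h3 : (2 : ℝ) * (Fintype.card V).choose 2 = (Fintype.card V : ℝ) ^ 2 - Fintype.card V := by
    rw [Nat.cast_choose_two]
    ring
  rw [← mul_assoc, h3] at h2
  linarith

/-- A configuration with one edge removed that is again a configuration, if there is one. -/
noncomputable def peel (D : Finset (Sym2 V)) : Finset (Sym2 V) :=
  open Classical in
  if h : ∃ e ∈ D, (boundary (D.erase e)).card = 0 ∨ (boundary (D.erase e)).card = 2 then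
    D.erase h.choose
  else D

omit [Fintype V] in
theorem symmDiff_singleton_of_mem {D : Finset (Sym2 V)} {e : Sym2 V} (he : e ∈ D) :
    symmDiff D {e} = D.erase e := by
  ext c
  simp only [Finset.mem_symmDiff, Finset.mem_singleton, Finset.mem_erase]
  constructor
  · rintro (h | h)
    · exact ⟨h.2, h.1⟩
    · exact absurd (h.1 ▸ he) h.2
  · exact fun h => Or.inl ⟨h.2, h.1⟩

/-- In an even set any edge will do, as its two endpoints become odd. With two odd vertices, an edge
wu at an odd vertex u is taken: the new boundary has 2|∂D \ {w, u}| vertices, and that difference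
misses u. -/
theorem exists_erase_card_boundary {D : Finset (Sym2 V)} (hD : D ∈ configurations G)
    (hne : D.Nonempty) :
    ∃ e ∈ D, (boundary (D.erase e)).card = 0 ∨ (boundary (D.erase e)).card = 2 := by
  rw [mem_configurations] at hD
  have hadj : ∀ a b, s(a, b) ∈ D → a ≠ b := fun a b hab =>
    ((SimpleGraph.mem_edgeFinset.mp (hD.1 hab) : G.Adj a b)).ne
  rcases hD.2 with h0 | h2
  · obtain ⟨e, he⟩ := hne
    refine ⟨e, he, Or.inr ?_⟩
    induction e using Sym2.ind with
    | _ a b =>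
      rw [← symmDiff_singleton_of_mem he, boundary_symmDiff, Finset.card_eq_zero.mp h0,
        ← Finset.bot_eq_empty, bot_symmDiff, boundary_singleton (hadj a b he),
        Finset.card_pair (hadj a b he)]
  · obtain ⟨u, hu⟩ : (boundary D).Nonempty := Finset.card_pos.mp (by omega)
    have hdeg : 0 < degreeIn D u := (Finset.mem_filter.mp hu).2.pos
    obtain ⟨w, hw⟩ := Finset.card_pos.mp hdeg
    have hw : s(w, u) ∈ D := (Finset.mem_filter.mp hw).2
    refine ⟨s(w, u), hw, ?_⟩
    rw [← symmDiff_singleton_of_mem hw, boundary_symmDiff, boundary_singleton (hadj w u hw)]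
    have h3 := card_symmDiff_add_card (boundary D) {w, u}
    rw [h2, Finset.card_pair (hadj w u hw)] at h3
    have h4 : (boundary D \ {w, u}).card < (boundary D).card :=
      Finset.card_lt_card ((Finset.ssubset_iff_of_subset Finset.sdiff_subset).mpr
      ⟨u, hu, by simp⟩)
    omega

theorem exists_peel_eq_erase {D : Finset (Sym2 V)} (hD : D ∈ configurations G)
    (hne : D.Nonempty) : ∃ e ∈ D, peel D = D.erase e := by
  have h := exists_erase_card_boundary hD hne
  exact ⟨h.choose, h.choose_spec.1, by rw [peel, dif_pos h]⟩

theorem peel_subset (D : Finset (Sym2 V)) : peel D ⊆ D := by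
  rw [peel]
  split_ifs
  · exact Finset.erase_subset _ _
  · exact subset_rfl

theorem peel_mem_configurations {D : Finset (Sym2 V)} (hD : D ∈ configurations G) :
    peel D ∈ configurations G := by
  rw [peel]
  split_ifs with h
  · rw [mem_configurations] at hD ⊢
    exact ⟨(Finset.erase_subset _ _).trans hD.1, h.choose_spec.2⟩
  · exact hD

theorem iterate_peel_mem_configurations {D : Finset (Sym2 V)} (hD : D ∈ configurations G)
    (i : ℕ) : peel^[i] D ∈ configurations G := by
  induction i with
  | zero => exact hD
  | succ i ih =>
    rw [Function.iterate_succ_apply']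
    exact peel_mem_configurations ih

theorem iterate_peel_antitone (D : Finset (Sym2 V)) : Antitone fun i => peel^[i] D :=
  antitone_nat_of_succ_le fun i => by
    rw [Function.iterate_succ_apply']
    exact peel_subset _

/-- The subtraction is truncated: after D is used up, peeling stays at ∅. -/
theorem card_iterate_peel {D : Finset (Sym2 V)} (hD : D ∈ configurations G) (i : ℕ) :
    (peel^[i] D).card = D.card - i := by
  induction i with
  | zero => rfl
  | succ i ih =>
    rw [Function.iterate_succ_apply']
    rcases (peel^[i] D).eq_empty_or_nonempty with h | h
    · have h1 := Finset.card_le_card (peel_subset (peel^[i] D))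
      rw [h] at ih h1 ⊢
      simp only [Finset.card_empty] at ih h1
      omega
    · obtain ⟨e, he, h'⟩ := exists_peel_eq_erase (iterate_peel_mem_configurations hD i) h
      rw [h', Finset.card_erase_of_mem he]
      omega

end Configurations

/-! ### Canonical paths and their congestion -/

section CanonicalPaths

variable {V : Type u} [Fintype V] [DecidableEq V] {G : SimpleGraph V} [DecidableRel G.Adj]

theorem iterate_peel_card_edgeFinset {D : Finset (Sym2 V)} (hD : D ∈ configurations G) :
    peel^[G.edgeFinset.card] D = ∅ := by
  have := Finset.card_le_card (mem_configurations.mp hD).1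
  rw [← Finset.card_eq_zero, card_iterate_peel hD]
  omega

/-- The difference telescopes along the peeling of D, and Cauchy–Schwarz costs the number of steps.
All paths are padded to length m by constant steps at F. -/
theorem sq_sub_le_sum_path (h : Finset (Sym2 V) → ℝ) (F : Finset (Sym2 V))
    {D : Finset (Sym2 V)} (hD : D ∈ configurations G) :
    (h (symmDiff F D) - h F) ^ 2 ≤ G.edgeFinset.card *
      ∑ i ∈ Finset.range G.edgeFinset.card,
        (h (symmDiff F (peel^[i] D)) - h (symmDiff F (peel^[i + 1] D))) ^ 2 := by
  have h1 := Finset.sum_range_sub' (fun i => h (symmDiff F (peel^[i] D))) G.edgeFinset.card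
  rw [iterate_peel_card_edgeFinset hD, ← Finset.bot_eq_empty, symmDiff_bot,
    Function.iterate_zero, id] at h1
  rw [← h1]
  refine sq_sum_le_card_mul_sum_sq.trans (le_of_eq ?_)
  rw [Finset.card_range]

variable (G) in
/-- The pairs of configurations that differ in one edge. -/
def neighborPairs : Finset (Finset (Sym2 V) × Finset (Sym2 V)) :=
  (configurations G ×ˢ configurations G).filter fun p => ∃ e ∈ G.edgeFinset, p.2 = symmDiff p.1 {e}

variable (G) in
/-- The steps of the canonical paths from `F ∆ D` to `F`. -/
def pathSteps : Finset (Finset (Sym2 V) × Finset (Sym2 V) × ℕ) :=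
  (configurations G ×ˢ oddFamily G 0 ×ˢ Finset.range G.edgeFinset.card).filter
    fun t => t.2.2 < t.1.card

/-- The pair of configurations traversed in a step. -/
noncomputable def stepPair (t : Finset (Sym2 V) × Finset (Sym2 V) × ℕ) :
    Finset (Sym2 V) × Finset (Sym2 V) :=
  (symmDiff t.2.1 (peel^[t.2.2] t.1), symmDiff t.2.1 (peel^[t.2.2 + 1] t.1))

theorem mem_pathSteps {D F : Finset (Sym2 V)} {i : ℕ} :
    (D, F, i) ∈ pathSteps G ↔
      D ∈ configurations G ∧ F ∈ oddFamily G 0 ∧ i < G.edgeFinset.card ∧ i < D.card := by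
  simp [pathSteps, and_assoc]

theorem exists_iterate_peel_succ {D F : Finset (Sym2 V)} {i : ℕ}
    (ht : (D, F, i) ∈ pathSteps G) :
    ∃ e ∈ peel^[i] D, peel^[i + 1] D = (peel^[i] D).erase e := by
  rw [mem_pathSteps] at ht
  rw [Function.iterate_succ_apply']
  refine exists_peel_eq_erase (iterate_peel_mem_configurations ht.1 i) (Finset.card_pos.mp ?_)
  rw [card_iterate_peel ht.1]
  omega

theorem stepPair_mem {t : Finset (Sym2 V) × Finset (Sym2 V) × ℕ} (ht : t ∈ pathSteps G) :
    stepPair t ∈ neighborPairs G := by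
  obtain ⟨D, F, i⟩ := t
  obtain ⟨e, he, h⟩ := exists_iterate_peel_succ ht
  rw [mem_pathSteps] at ht
  have hi := iterate_peel_mem_configurations ht.1 i
  simp only [neighborPairs, stepPair, Finset.mem_filter, Finset.mem_product]
  refine ⟨⟨symmDiff_mem_configurations ht.2.1 hi, symmDiff_mem_configurations ht.2.1
    (iterate_peel_mem_configurations ht.1 _)⟩, e, (mem_configurations.mp hi).1 he, ?_⟩
  rw [h, ← symmDiff_singleton_of_mem he, symmDiff_assoc]

/-- The two configurations of a step differ in the peeled edge. Peeling D removes each edge only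
once, so this edge fixes i, and then F is recovered by cancelling `peel^[i] D`. -/
theorem eq_of_stepPair_eq {D F F' : Finset (Sym2 V)} {i i' : ℕ}
    (ht : (D, F, i) ∈ pathSteps G) (ht' : (D, F', i') ∈ pathSteps G)
    (h : stepPair (D, F, i) = stepPair (D, F', i')) : i = i' ∧ F = F' := by
  simp only [stepPair, Prod.mk.injEq] at h
  have key : ∀ {F F' : Finset (Sym2 V)} {i i' : ℕ}, (D, F, i) ∈ pathSteps G →
      symmDiff F (peel^[i] D) = symmDiff F' (peel^[i'] D) →
      symmDiff F (peel^[i + 1] D) = symmDiff F' (peel^[i' + 1] D) → ¬ i < i' := by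
    intro F F' i i' ht h1 h2 hlt
    obtain ⟨e, he, hs⟩ := exists_iterate_peel_succ ht
    have h3 : symmDiff (peel^[i] D) (peel^[i + 1] D) =
        symmDiff (peel^[i'] D) (peel^[i' + 1] D) := by
      have := congrArg₂ symmDiff h1 h2
      rwa [symmDiff_symmDiff_symmDiff_comm, symmDiff_self, bot_symmDiff,
        symmDiff_symmDiff_symmDiff_comm, symmDiff_self, bot_symmDiff] at this
    have h4 : e ∈ symmDiff (peel^[i'] D) (peel^[i' + 1] D) := by
      rw [← h3, hs, Finset.mem_symmDiff]
      simp [he]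
    have h5 : e ∈ peel^[i + 1] D := by
      rcases Finset.mem_symmDiff.mp h4 with h | h
      · exact iterate_peel_antitone D (show i + 1 ≤ i' by omega) h.1
      · exact iterate_peel_antitone D (show i + 1 ≤ i' + 1 by omega) h.1
    rw [hs] at h5
    simp at h5
  have hi : i = i' := by
    have h1 := key ht h.1 h.2
    have h2 := key ht' h.1.symm h.2.symm
    omega
  subst hi
  exact ⟨rfl, symmDiff_left_injective _ h.1⟩

/-- Along the path only edges of D change, so (A ∪ A') \ D = F \ D, and both sides equal 2|F \ D| +
|D|. This trades the weights of the endpoints for that of the step and that of a translate of D. -/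
theorem card_add_card_eq_of_stepPair {D F : Finset (Sym2 V)} (i : ℕ)
    {A A' : Finset (Sym2 V)} (h : stepPair (D, F, i) = (A, A')) :
    (symmDiff F D).card + F.card = (symmDiff D (A ∪ A')).card + (A ∪ A').card := by
  simp only [stepPair, Prod.mk.injEq] at h
  have h1 := card_symmDiff_add_card F D
  have h2 := card_symmDiff_add_card (A ∪ A') D
  have h3 : (A ∪ A') \ D = F \ D := by
    rw [← h.1, ← h.2]
    have s0 := iterate_peel_antitone D (Nat.zero_le i)
    have s1 := iterate_peel_antitone D (Nat.zero_le (i + 1))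
    ext e
    have t0 : e ∈ peel^[i] D → e ∈ D := fun h => s0 h
    have t1 : e ∈ peel^[i + 1] D → e ∈ D := fun h => s1 h
    simp only [Finset.mem_sdiff, Finset.mem_union, Finset.mem_symmDiff]
    tauto
  rw [h3, symmDiff_comm] at h2
  omega

/-- The congestion bound: D encodes a step through p injectively, so the sum over steps is dominated
by the sum over all D in W. -/
theorem sum_fiber_le {x : ℝ} (hx : 0 ≤ x) (hx1 : x ≤ 1) (p : Finset (Sym2 V) × Finset (Sym2 V))
    (hp : p ∈ neighborPairs G) :
    ∑ t ∈ (pathSteps G).filter (fun t => stepPair t = p),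
      multiplicity G t.1 * x ^ ((symmDiff t.2.1 t.1).card + t.2.1.card) ≤
      x ^ (p.1 ∪ p.2).card * ((Fintype.card V : ℝ) ^ 2 * weight x (oddFamily G 0)) := by
  have hU : p.1 ∪ p.2 ⊆ G.edgeFinset := by
    simp only [neighborPairs, Finset.mem_filter, Finset.mem_product, mem_configurations] at hp
    exact Finset.union_subset hp.1.1.1 hp.1.2.1
  have e : ∑ t ∈ (pathSteps G).filter (fun t => stepPair t = p),
      multiplicity G t.1 * x ^ ((symmDiff t.2.1 t.1).card + t.2.1.card) =
      ∑ t ∈ (pathSteps G).filter (fun t => stepPair t = p),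
        x ^ (p.1 ∪ p.2).card * (multiplicity G t.1 * x ^ (symmDiff t.1 (p.1 ∪ p.2)).card) := by
    refine Finset.sum_congr rfl fun t ht => ?_
    rw [card_add_card_eq_of_stepPair t.2.2 (Finset.mem_filter.mp ht).2, pow_add]
    ring
  rw [e, ← Finset.mul_sum]
  refine mul_le_mul_of_nonneg_left ?_ (pow_nonneg hx _)
  refine le_trans ?_ (sum_multiplicity_mul_pow_le hx hx1 hU)
  have hinj : Set.InjOn Prod.fst
      ((pathSteps G).filter (fun t => stepPair t = p) :
        Set (Finset (Sym2 V) × Finset (Sym2 V) × ℕ)) := by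
    rintro ⟨D, F, i⟩ ht ⟨D', F', i'⟩ ht' (rfl : D = D')
    simp only [Finset.coe_filter, Set.mem_ofPred_eq] at ht ht'
    obtain ⟨rfl, rfl⟩ := eq_of_stepPair_eq ht.1 ht'.1 (ht.2.trans ht'.2.symm)
    rfl
  rw [← Finset.sum_image (g := Prod.fst)
    (f := fun D => multiplicity G D * x ^ (symmDiff D (p.1 ∪ p.2)).card) hinj]
  refine Finset.sum_le_sum_of_subset_of_nonneg ?_ fun D _ _ =>
    mul_nonneg (multiplicity_nonneg D) (pow_nonneg hx _)
  intro D hD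
  obtain ⟨⟨D', F, i⟩, ht, rfl⟩ := Finset.mem_image.mp hD
  exact (mem_pathSteps.mp (Finset.mem_filter.mp ht).1).1

/-- The comparison of the variance with the Dirichlet form by canonical paths, for the
translations of a configuration by an even configuration. -/
theorem sum_symmDiff_sq_le {x : ℝ} (hx : 0 ≤ x) (hx1 : x ≤ 1) (h : Finset (Sym2 V) → ℝ) :
    ∑ D ∈ configurations G, ∑ F ∈ oddFamily G 0,
      multiplicity G D * x ^ ((symmDiff F D).card + F.card) * (h (symmDiff F D) - h F) ^ 2 ≤
      G.edgeFinset.card * ((Fintype.card V : ℝ) ^ 2 * weight x (oddFamily G 0)) *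
        ∑ p ∈ neighborPairs G, x ^ (p.1 ∪ p.2).card * (h p.1 - h p.2) ^ 2 := by
  set w : Finset (Sym2 V) → Finset (Sym2 V) → ℝ := fun D F =>
    multiplicity G D * x ^ ((symmDiff F D).card + F.card) with hw
  have hw0 : ∀ D F, 0 ≤ w D F := fun D F =>
    mul_nonneg (multiplicity_nonneg D) (pow_nonneg hx _)
  calc ∑ D ∈ configurations G, ∑ F ∈ oddFamily G 0, w D F * (h (symmDiff F D) - h F) ^ 2
      ≤ ∑ D ∈ configurations G, ∑ F ∈ oddFamily G 0, w D F * (G.edgeFinset.card *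
          ∑ i ∈ Finset.range G.edgeFinset.card,
            (h (stepPair (D, F, i)).1 - h (stepPair (D, F, i)).2) ^ 2) :=
        Finset.sum_le_sum fun D hD => Finset.sum_le_sum fun F _ =>
          mul_le_mul_of_nonneg_left (sq_sub_le_sum_path h F hD) (hw0 D F)
    _ = G.edgeFinset.card * ∑ t ∈ configurations G ×ˢ oddFamily G 0 ×ˢ
          Finset.range G.edgeFinset.card,
            w t.1 t.2.1 * (h (stepPair t).1 - h (stepPair t).2) ^ 2 := by
        rw [Finset.sum_product, Finset.mul_sum]
        refine Finset.sum_congr rfl fun D _ => ?_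
        rw [Finset.sum_product, Finset.mul_sum]
        refine Finset.sum_congr rfl fun F _ => ?_
        simp only [Finset.mul_sum]
        exact Finset.sum_congr rfl fun i _ => by ring
    -- The padding steps contribute zero; they must be dropped because the encoding is injective
    -- only on genuine steps.
    _ = G.edgeFinset.card * ∑ t ∈ pathSteps G,
            w t.1 t.2.1 * (h (stepPair t).1 - h (stepPair t).2) ^ 2 := by
        congr 1
        symm
        refine Finset.sum_filter_of_ne ?_
        rintro ⟨D, F, i⟩ ht hne
        by_contra hle
        refine hne ?_
        simp only [Finset.mem_product] at ht
        have hz : ∀ j, D.card ≤ j → peel^[j] D = ∅ := fun j hj => by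
          rw [← Finset.card_eq_zero, card_iterate_peel ht.1]
          omega
        simp only [not_lt] at hle
        simp [stepPair, hz i hle, hz (i + 1) (by omega)]
    _ = G.edgeFinset.card * ∑ p ∈ neighborPairs G,
          (∑ t ∈ (pathSteps G).filter (fun t => stepPair t = p), w t.1 t.2.1) *
            (h p.1 - h p.2) ^ 2 := by
        rw [← Finset.sum_fiberwise_of_maps_to (g := stepPair) (t := neighborPairs G)
          fun t ht => stepPair_mem ht]
        congr 1
        refine Finset.sum_congr rfl fun p _ => ?_
        rw [Finset.sum_mul]
        refine Finset.sum_congr rfl fun t ht => ?_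
        rw [(Finset.mem_filter.mp ht).2]
    _ ≤ G.edgeFinset.card * ∑ p ∈ neighborPairs G,
          (x ^ (p.1 ∪ p.2).card * ((Fintype.card V : ℝ) ^ 2 * weight x (oddFamily G 0))) *
            (h p.1 - h p.2) ^ 2 := by
        refine mul_le_mul_of_nonneg_left (Finset.sum_le_sum fun p hp => ?_) (Nat.cast_nonneg _)
        exact mul_le_mul_of_nonneg_right (sum_fiber_le hx hx1 p hp) (sq_nonneg _)
    _ = _ := by
        simp only [Finset.mul_sum]
        exact Finset.sum_congr rfl fun p _ => by ring

/-- The same comparison, for all pairs of a configuration and an even configuration. -/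
theorem sum_configurations_sq_le {x : ℝ} (hx : 0 ≤ x) (hx1 : x ≤ 1)
    (h : Finset (Sym2 V) → ℝ) :
    ∑ I ∈ configurations G, ∑ F ∈ oddFamily G 0,
      multiplicity G I * x ^ I.card * x ^ F.card * (h I - h F) ^ 2 ≤
      G.edgeFinset.card * ((Fintype.card V : ℝ) ^ 2 * weight x (oddFamily G 0)) *
        ∑ p ∈ neighborPairs G, x ^ (p.1 ∪ p.2).card * (h p.1 - h p.2) ^ 2 := by
  refine le_trans (le_of_eq ?_) (sum_symmDiff_sq_le hx hx1 h)
  rw [Finset.sum_comm, Finset.sum_comm (s := configurations G)]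
  refine Finset.sum_congr rfl fun F hF => ?_
  -- For fixed even F, translation by F is an involution of W that preserves ψ.
  refine Finset.sum_nbij' (fun D => symmDiff F D) (fun D => symmDiff F D)
    (fun D hD => symmDiff_mem_configurations hF hD)
    (fun D hD => symmDiff_mem_configurations hF hD)
    (fun D _ => symmDiff_symmDiff_cancel_left _ _)
    (fun D _ => symmDiff_symmDiff_cancel_left _ _) fun D hD => ?_
  rw [multiplicity_symmDiff hF hD, symmDiff_symmDiff_cancel_left, pow_add]
  ring

end CanonicalPaths

/-! ### Stationary flow: detailed balance, lower bound, laziness -/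

section Flow

variable {V : Type u} [Fintype V] [DecidableEq V] {G : SimpleGraph V} [DecidableRel G.Adj]

theorem mem_oddFamily_two_of_not_zero {A : State G}
    (hA : (A : Finset (Sym2 V)) ∉ oddFamily G 0) : (A : Finset (Sym2 V)) ∈ oddFamily G 2 :=
  (Finset.mem_union.mp A.2).resolve_left hA

omit [Fintype V] in
theorem flip_symm {A B : Finset (Sym2 V)} {u v : V} (hB : B = symmDiff A {s(u, v)}) :
    A = symmDiff B {s(v, u)} := by
  rw [hB, Sym2.eq_swap, symmDiff_symmDiff_cancel_right]

theorem card_boundary_sdiff_of_flip {A B : Finset (Sym2 V)} {u v : V} (huv : u ≠ v)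
    (hB : B = symmDiff A {s(u, v)}) (hA2 : (boundary A).card = 2)
    (hB2 : (boundary B).card = 2) : (boundary A \ {u, v}).card = 1 := by
  have h := card_symmDiff_add_card (boundary A) {u, v}
  rw [← boundary_singleton huv, ← boundary_symmDiff, ← hB, hA2, hB2, boundary_singleton huv,
    Finset.card_pair huv] at h
  omega

theorem not_mem_zero_of_flip {A B : Finset (Sym2 V)} {u v : V} (huv : u ≠ v)
    (hB : B = symmDiff A {s(u, v)}) (hA : A ∈ oddFamily G 0) : B ∉ oddFamily G 0 := by
  rw [mem_oddFamily_zero] at hA ⊢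
  rintro ⟨-, h⟩
  have := (boundary_flip A huv u).mp
  rw [← hB, h, hA.2] at this
  have h2 := (boundary_flip A huv u).mpr
  rw [← hB, h, hA.2] at h2
  simp at h2

omit [Fintype V] in
theorem pow_card_mul_flip {x : ℝ} {A B : Finset (Sym2 V)} {e : Sym2 V}
    (hB : B = symmDiff A {e}) :
    x ^ A.card * (if e ∈ A then 1 else x) = x ^ (A ∪ B).card := by
  by_cases he : e ∈ A
  · rw [symmDiff_singleton_of_mem he] at hB
    rw [if_pos he, mul_one, hB, Finset.union_eq_left.mpr (Finset.erase_subset _ _)]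
  · have h : A ∪ B = insert e A := by
      rw [hB]
      ext c
      simp only [Finset.mem_union, Finset.mem_symmDiff, Finset.mem_singleton, Finset.mem_insert]
      by_cases hc : c = e
      · subst hc; simp [he]
      · simp [hc]
    rw [if_neg he, h, Finset.card_insert_of_notMem he, pow_succ]

omit [Fintype V] in
theorem pow_card_mul_flip_inv {x : ℝ} (hx : x ≠ 0) {A B : Finset (Sym2 V)} {e : Sym2 V}
    (hB : B = symmDiff A {e}) :
    x ^ A.card * (if e ∈ A then x⁻¹ else x) = x ^ B.card := by
  by_cases he : e ∈ A
  · rw [symmDiff_singleton_of_mem he] at hB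
    have h := Finset.card_erase_add_one he
    rw [if_pos he, hB, ← h, pow_succ, mul_assoc, mul_inv_cancel₀ hx, mul_one]
  · have h : B = insert e A := by
      rw [hB]
      ext c
      simp only [Finset.mem_symmDiff, Finset.mem_singleton, Finset.mem_insert]
      by_cases hc : c = e
      · subst hc; simp [he]
      · simp [hc]
    rw [if_neg he, h, Finset.card_insert_of_notMem he, pow_succ]

/-- The unnormalized stationary flow from `A` to `B`. -/
noncomputable def flow (x : ℝ) (A B : State G) : ℝ :=
  x ^ (A : Finset (Sym2 V)).card * psi G A * transitionMatrix G x A B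

omit [DecidableEq V] [DecidableRel G.Adj] in
theorem card_vertices_pos_of_adj {u v : V} (_ : G.Adj u v) : (0 : ℝ) < Fintype.card V :=
  Nat.cast_pos.mpr (Fintype.card_pos_iff.mpr ⟨u⟩)

omit [DecidableEq V] in
theorem degree_pos_of_adj {u v : V} (huv : G.Adj u v) : (0 : ℝ) < G.degree u :=
  Nat.cast_pos.mpr ((G.degree_pos_iff_exists_adj u).mpr ⟨v, huv⟩)

/-- The factor ψ = n cancels the 1/n of the transition probability, leaving an expression symmetric
in A and B that agrees with `flow_to_zero`. -/
theorem flow_from_zero (x : ℝ) {A B : State G} {u v : V} (huv : G.Adj u v)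
    (hB : (B : Finset (Sym2 V)) = symmDiff (A : Finset (Sym2 V)) {s(u, v)})
    (hA0 : (A : Finset (Sym2 V)) ∈ oddFamily G 0) :
    flow x A B = x ^ ((A : Finset (Sym2 V)) ∪ B).card *
      (1 / 2 * (1 / G.degree u + 1 / G.degree v)) := by
  rw [flow, transitionMatrix_from_zero x huv hB hA0, ← pow_card_mul_flip hB, psi, if_pos hA0]
  have := card_vertices_pos_of_adj huv
  field_simp

theorem flow_to_zero (x : ℝ) {A B : State G} {u v : V} (huv : G.Adj u v)
    (hB : (B : Finset (Sym2 V)) = symmDiff (A : Finset (Sym2 V)) {s(u, v)})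
    (hA0 : (A : Finset (Sym2 V)) ∉ oddFamily G 0) (hB0 : (B : Finset (Sym2 V)) ∈ oddFamily G 0) :
    flow x A B = x ^ ((A : Finset (Sym2 V)) ∪ B).card *
      (1 / 2 * (1 / G.degree u + 1 / G.degree v)) := by
  rw [flow, transitionMatrix_to_zero x huv hB hA0 hB0, ← pow_card_mul_flip hB, psi, if_neg hA0]
  ring

/-- This form of the Metropolis rule is invariant under exchanging (A, u) with (B, v), which makes
detailed balance visible. -/
theorem flow_two_two {x : ℝ} (hx : 0 < x) {A B : State G} {u v : V} (huv : G.Adj u v)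
    (hB : (B : Finset (Sym2 V)) = symmDiff (A : Finset (Sym2 V)) {s(u, v)})
    (hA0 : (A : Finset (Sym2 V)) ∉ oddFamily G 0) (hB0 : (B : Finset (Sym2 V)) ∉ oddFamily G 0)
    (hu : u ∈ boundary (A : Finset (Sym2 V))) :
    flow x A B = 1 / 2 * min (x ^ (B : Finset (Sym2 V)).card / G.degree v)
      (x ^ (A : Finset (Sym2 V)).card / G.degree u) := by
  rw [flow, transitionMatrix_two_two x huv hB (mem_oddFamily_two_of_not_zero hA0)
    (mem_oddFamily_two_of_not_zero hB0) hu, psi, if_neg hA0, ← pow_card_mul_flip_inv hx.ne' hB]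
  have hdu := degree_pos_of_adj huv
  have hdv := degree_pos_of_adj huv.symm
  set r := if s(u, v) ∈ (A : Finset (Sym2 V)) then x⁻¹ else x
  set y := x ^ (A : Finset (Sym2 V)).card
  have hy : 0 < y := pow_pos hx _
  have h1 : y * r / G.degree v = y / G.degree u * (G.degree u / G.degree v * r) := by
    field_simp
  have h2 : min (y * r / G.degree v) (y / G.degree u) =
      y / G.degree u * min (G.degree u / G.degree v * r) 1 := by
    rw [h1, mul_min_of_nonneg _ _ (by positivity), mul_one]
  rw [h2]
  field_simp
  ring

/-- If both or neither of the endpoints were odd, the flip would change the number of odd vertices;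
so the flip moves an odd vertex across the edge. -/
theorem boundary_of_flip_two_two {A B : State G} {u v : V} (huv : G.Adj u v)
    (hB : (B : Finset (Sym2 V)) = symmDiff (A : Finset (Sym2 V)) {s(u, v)})
    (hA0 : (A : Finset (Sym2 V)) ∉ oddFamily G 0) (hB0 : (B : Finset (Sym2 V)) ∉ oddFamily G 0) :
    (u ∈ boundary (A : Finset (Sym2 V)) ∧ v ∈ boundary (B : Finset (Sym2 V))) ∨
      (v ∈ boundary (A : Finset (Sym2 V)) ∧ u ∈ boundary (B : Finset (Sym2 V))) := by
  have hA2 := (mem_oddFamily.mp (mem_oddFamily_two_of_not_zero hA0)).2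
  have hB2 := (mem_oddFamily.mp (mem_oddFamily_two_of_not_zero hB0)).2
  have h1 := card_boundary_sdiff_of_flip huv.ne hB hA2 hB2
  have hu := boundary_flip (A : Finset (Sym2 V)) huv.ne u
  have hv := boundary_flip (A : Finset (Sym2 V)) huv.ne v
  rw [← hB] at hu hv
  by_cases hu1 : u ∈ boundary (A : Finset (Sym2 V)) <;>
    by_cases hv1 : v ∈ boundary (A : Finset (Sym2 V))
  · have h2 := Finset.card_sdiff_add_card_eq_card
      (show ({u, v} : Finset V) ⊆ boundary (A : Finset (Sym2 V)) by
        simp [Finset.insert_subset_iff, hu1, hv1])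
    rw [Finset.card_pair huv.ne] at h2
    omega
  · exact Or.inl ⟨hu1, by rw [hv]; simp [hv1]⟩
  · exact Or.inr ⟨hv1, by rw [hu]; simp [hu1]⟩
  · have h2 : boundary (A : Finset (Sym2 V)) \ {u, v} = boundary (A : Finset (Sym2 V)) := by
      rw [Finset.sdiff_eq_self_iff_disjoint, Finset.disjoint_right]
      simp [hu1, hv1]
    rw [h2] at h1
    omega

theorem flow_comm_of_flip {x : ℝ} (hx : 0 < x) {A B : State G} {u v : V} (huv : G.Adj u v)
    (hB : (B : Finset (Sym2 V)) = symmDiff (A : Finset (Sym2 V)) {s(u, v)}) :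
    flow x A B = flow x B A := by
  by_cases hA0 : (A : Finset (Sym2 V)) ∈ oddFamily G 0
  · rw [flow_from_zero x huv hB hA0, flow_to_zero x huv.symm (flip_symm hB)
      (not_mem_zero_of_flip huv.ne hB hA0) hA0, Finset.union_comm,
      add_comm (1 / (G.degree u : ℝ))]
  · by_cases hB0 : (B : Finset (Sym2 V)) ∈ oddFamily G 0
    · rw [flow_to_zero x huv hB hA0 hB0, flow_from_zero x huv.symm (flip_symm hB) hB0,
        Finset.union_comm, add_comm (1 / (G.degree u : ℝ))]
    · rcases boundary_of_flip_two_two huv hB hA0 hB0 with ⟨h1, h2⟩ | ⟨h1, h2⟩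
      · rw [flow_two_two hx huv hB hA0 hB0 h1,
          flow_two_two hx huv.symm (flip_symm hB) hB0 hA0 h2, min_comm]
      · rw [Sym2.eq_swap] at hB
        rw [flow_two_two hx huv.symm hB hA0 hB0 h1,
          flow_two_two hx huv (flip_symm hB) hB0 hA0 h2, min_comm]

theorem moveProbability_eq_zero (x : ℝ) {A B : State G}
    (h : ∀ u v, G.Adj u v → (B : Finset (Sym2 V)) ≠ symmDiff (A : Finset (Sym2 V)) {s(u, v)}) :
    moveProbability G x A B = 0 :=
  Finset.sum_eq_zero fun u _ => Finset.sum_eq_zero fun v hv =>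
    if_neg (h u v ((G.mem_neighborFinset u v).mp hv))

theorem flow_comm {x : ℝ} (hx : 0 < x) (A B : State G) : flow x A B = flow x B A := by
  by_cases hAB : A = B
  · rw [hAB]
  · by_cases h : ∃ u v, G.Adj u v ∧
        (B : Finset (Sym2 V)) = symmDiff (A : Finset (Sym2 V)) {s(u, v)}
    · obtain ⟨u, v, huv, hB⟩ := h
      exact flow_comm_of_flip hx huv hB
    · have h1 : moveProbability G x A B = 0 :=
        moveProbability_eq_zero x fun u v huv hB => h ⟨u, v, huv, hB⟩
      have h2 : moveProbability G x B A = 0 :=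
        moveProbability_eq_zero x fun u v huv hA => h ⟨v, u, huv.symm, flip_symm hA⟩
      simp only [flow, transitionMatrix, if_neg hAB, if_neg (Ne.symm hAB), h1, h2, mul_zero]

omit [DecidableEq V] in
theorem inv_maxDegree_le_of_adj {u v : V} (huv : G.Adj u v) :
    (1 : ℝ) / G.maxDegree ≤ 1 / G.degree u :=
  one_div_le_one_div_of_le (degree_pos_of_adj huv) (Nat.cast_le.mpr (G.degree_le_maxDegree u))

/-- The exponent |A ∪ B| is the one in the congestion bound. Between two elements of C_2 it is a
loss, harmless since x ≤ 1. -/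
theorem le_flow {x : ℝ} (hx : 0 < x) (hx1 : x ≤ 1) {A B : State G} {u v : V}
    (huv : G.Adj u v)
    (hB : (B : Finset (Sym2 V)) = symmDiff (A : Finset (Sym2 V)) {s(u, v)}) :
    x ^ ((A : Finset (Sym2 V)) ∪ B).card * (1 / (2 * G.maxDegree)) ≤ flow x A B := by
  have hu := inv_maxDegree_le_of_adj huv
  have hv := inv_maxDegree_le_of_adj huv.symm
  have h0 : (0 : ℝ) ≤ 1 / G.maxDegree := by positivity
  have hxU := pow_pos hx ((A : Finset (Sym2 V)) ∪ B).card
  have e : (1 : ℝ) / (2 * G.maxDegree) = 1 / 2 * (1 / G.maxDegree) := by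
    rw [one_div_mul_one_div]
  have h2 : ∀ {A B : State G} {u v : V}, G.Adj u v →
      (B : Finset (Sym2 V)) = symmDiff (A : Finset (Sym2 V)) {s(u, v)} →
      (A : Finset (Sym2 V)) ∉ oddFamily G 0 → (B : Finset (Sym2 V)) ∉ oddFamily G 0 →
      u ∈ boundary (A : Finset (Sym2 V)) →
      x ^ ((A : Finset (Sym2 V)) ∪ B).card * (1 / 2 * (1 / G.maxDegree)) ≤ flow x A B := by
    intro A B u v huv hB hA0 hB0 h1
    rw [flow_two_two hx huv hB hA0 hB0 h1, mul_left_comm]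
    refine mul_le_mul_of_nonneg_left (le_min ?_ ?_) (by norm_num)
    · rw [div_eq_mul_one_div (x ^ (B : Finset (Sym2 V)).card)]
      exact mul_le_mul (pow_le_pow_of_le_one hx.le hx1
        (Finset.card_le_card Finset.subset_union_right)) (inv_maxDegree_le_of_adj huv.symm)
        (by positivity) (by positivity)
    · rw [div_eq_mul_one_div (x ^ (A : Finset (Sym2 V)).card)]
      exact mul_le_mul (pow_le_pow_of_le_one hx.le hx1
        (Finset.card_le_card Finset.subset_union_left)) (inv_maxDegree_le_of_adj huv)
        (by positivity) (by positivity)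
  rw [e]
  by_cases hA0 : (A : Finset (Sym2 V)) ∈ oddFamily G 0
  · rw [flow_from_zero x huv hB hA0]
    exact mul_le_mul_of_nonneg_left (by linarith) hxU.le
  · by_cases hB0 : (B : Finset (Sym2 V)) ∈ oddFamily G 0
    · rw [flow_to_zero x huv hB hA0 hB0]
      exact mul_le_mul_of_nonneg_left (by linarith) hxU.le
    · rcases boundary_of_flip_two_two huv hB hA0 hB0 with ⟨h1, -⟩ | ⟨h1, -⟩
      · exact h2 huv hB hA0 hB0 h1
      · rw [Sym2.eq_swap] at hB
        exact h2 huv.symm hB hA0 hB0 h1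

theorem flipProbability_nonneg {x : ℝ} (hx : 0 ≤ x) (A B : State G) (u v : V) :
    0 ≤ flipProbability G x A B u v := by
  unfold flipProbability
  split_ifs <;> positivity

/-- A flip from C_2 into C_0 has both endpoints odd in A, so in every case with A in C_2 the first
chosen vertex lies in ∂A. -/
theorem flipProbability_le {x : ℝ} (hx1 : x ≤ 1) {A B : State G} {u v : V}
    (huv : G.Adj u v)
    (hB : (B : Finset (Sym2 V)) = symmDiff (A : Finset (Sym2 V)) {s(u, v)}) :
    flipProbability G x A B u v ≤
      (if (A : Finset (Sym2 V)) ∈ oddFamily G 0 then 1 / (2 * (Fintype.card V : ℝ))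
        else if u ∈ boundary (A : Finset (Sym2 V)) then 1 / 4 else 0) * (1 / G.degree u) := by
  have hr : (if s(u, v) ∈ (A : Finset (Sym2 V)) then 1 else x) ≤ 1 := by
    split_ifs
    · exact le_rfl
    · exact hx1
  unfold flipProbability
  by_cases hA0 : (A : Finset (Sym2 V)) ∈ oddFamily G 0
  · rw [if_pos hA0, if_pos hA0]
    exact mul_le_of_le_one_left (by positivity) hr
  · rw [if_neg hA0, if_neg hA0]
    by_cases hB0 : (B : Finset (Sym2 V)) ∈ oddFamily G 0
    · have hu : u ∈ boundary (A : Finset (Sym2 V)) := by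
        have h := boundary_flip (A : Finset (Sym2 V)) huv.ne u
        rw [← hB, (mem_oddFamily_zero.mp hB0).2] at h
        by_contra hu
        simp [hu] at h
      rw [if_pos hB0, if_pos hu]
      exact mul_le_of_le_one_left (by positivity) hr
    · rw [if_neg hB0]
      by_cases hu : u ∈ boundary (A : Finset (Sym2 V))
      · rw [if_pos hu, if_pos hu, one_div_mul_one_div]
        exact mul_le_of_le_one_left (by positivity) (min_le_right _ _)
      · simp [hu]

theorem moveProbability_nonneg {x : ℝ} (hx : 0 ≤ x) (A B : State G) :
    0 ≤ moveProbability G x A B :=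
  Finset.sum_nonneg fun u _ => Finset.sum_nonneg fun v _ => by
    split_ifs
    · exact flipProbability_nonneg hx A B u v
    · exact le_rfl

/-- The first vertex is chosen with total mass at most 1/2, either n · 1/(2n) or 2 · 1/4, and the
factors 1/d(u) sum to at most 1 over its neighbours. -/
theorem sum_moveProbability_le {x : ℝ} (hx1 : x ≤ 1) (A : State G) :
    ∑ B ∈ Finset.univ.erase A, moveProbability G x A B ≤ 1 / 2 := by
  set β : V → ℝ := fun u =>
    if (A : Finset (Sym2 V)) ∈ oddFamily G 0 then 1 / (2 * (Fintype.card V : ℝ))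
      else if u ∈ boundary (A : Finset (Sym2 V)) then 1 / 4 else 0 with hβ
  have hβ0 : ∀ u, 0 ≤ β u := fun u => by
    simp only [hβ]
    split_ifs <;> positivity
  have hβ1 : ∑ u, β u ≤ 1 / 2 := by
    simp only [hβ]
    split_ifs with hA0
    · rw [Finset.sum_const, Finset.card_univ, nsmul_eq_mul]
      rcases Nat.eq_zero_or_pos (Fintype.card V) with h | h
      · simp [h]
      · have : (0 : ℝ) < Fintype.card V := Nat.cast_pos.mpr h
        apply le_of_eq
        field_simp
    · rw [Finset.sum_ite_mem, Finset.univ_inter, Finset.sum_const,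
        (mem_oddFamily.mp (mem_oddFamily_two_of_not_zero hA0)).2]
      norm_num
  refine le_trans ?_ hβ1
  simp only [moveProbability]
  rw [Finset.sum_comm]
  refine Finset.sum_le_sum fun u _ => ?_
  rw [Finset.sum_comm]
  have h1 : ∀ v ∈ G.neighborFinset u, ∑ B ∈ Finset.univ.erase A,
      (if (B : Finset (Sym2 V)) = symmDiff (A : Finset (Sym2 V)) {s(u, v)} then
        flipProbability G x A B u v else 0) ≤ β u * (1 / G.degree u) := by
    intro v hv
    rw [SimpleGraph.mem_neighborFinset] at hv
    by_cases h : ∃ B ∈ Finset.univ.erase A,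
        (B : Finset (Sym2 V)) = symmDiff (A : Finset (Sym2 V)) {s(u, v)}
    · obtain ⟨B, hBA, hB⟩ := h
      rw [Finset.sum_eq_single_of_mem B hBA, if_pos hB]
      · exact flipProbability_le hx1 hv hB
      · intro B' _ hne
        exact if_neg fun hB' => hne (Subtype.ext (hB'.trans hB.symm))
    · push Not at h
      rw [Finset.sum_eq_zero fun B hB => if_neg (h B hB)]
      exact mul_nonneg (hβ0 u) (by positivity)
  refine (Finset.sum_le_sum h1).trans ?_
  rw [Finset.sum_const, G.card_neighborFinset_eq_degree, nsmul_eq_mul]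
  rcases Nat.eq_zero_or_pos (G.degree u) with h | h
  · simp [h, hβ0 u]
  · have : (0 : ℝ) < G.degree u := Nat.cast_pos.mpr h
    apply le_of_eq
    field_simp

end Flow

/-! ### Reversibility and the Poincaré inequality -/

section Stationarity

variable {V : Type u} [Fintype V] [DecidableEq V] (G : SimpleGraph V) [DecidableRel G.Adj]

/-- The normalizing constant of the Prokof'ev-Svistunov measure. -/
noncomputable def normalization (x : ℝ) : ℝ :=
  Fintype.card V * weight x (oddFamily G 0) + 2 * weight x (oddFamily G 2)

variable {G}

omit [Fintype V] [DecidableEq V] in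
theorem weight_nonneg {x : ℝ} (hx : 0 ≤ x) (S : Finset (Finset (Sym2 V))) : 0 ≤ weight x S :=
  Finset.sum_nonneg fun _ _ => pow_nonneg hx _

theorem empty_mem_oddFamily : (∅ : Finset (Sym2 V)) ∈ oddFamily G 0 := by
  rw [mem_oddFamily_zero]
  exact ⟨Finset.empty_subset _, boundary_empty⟩

theorem weight_zero_pos {x : ℝ} (hx : 0 < x) : 0 < weight x (oddFamily G 0) :=
  Finset.sum_pos (fun _ _ => pow_pos hx _) ⟨∅, empty_mem_oddFamily⟩

theorem normalization_pos [Nonempty V] {x : ℝ} (hx : 0 < x) : 0 < normalization G x := by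
  have h1 := weight_zero_pos (G := G) hx
  have h2 := weight_nonneg hx.le (oddFamily G 2)
  have h3 : (0 : ℝ) < Fintype.card V := Nat.cast_pos.mpr Fintype.card_pos
  rw [normalization]
  positivity

theorem sum_pow_mul_multiplicity (x : ℝ) :
    ∑ A ∈ configurations G, x ^ A.card * multiplicity G A = normalization G x := by
  rw [configurations, Finset.sum_union disjoint_oddFamily, normalization, weight, weight,
    Finset.mul_sum, Finset.mul_sum]
  congr 1
  · refine Finset.sum_congr rfl fun A hA => ?_
    rw [multiplicity, if_pos hA, mul_comm]
  · refine Finset.sum_congr rfl fun A hA => ?_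
    rw [multiplicity, if_neg (Finset.disjoint_right.mp disjoint_oddFamily hA), mul_comm]

theorem psMeasure_mul_transitionMatrix (x : ℝ) (A B : State G) :
    psMeasure G x A * transitionMatrix G x A B = flow x A B / normalization G x := by
  rw [psMeasure, flow, normalization]
  ring

theorem isLazyReversible_transitionMatrix [Nonempty V] {x : ℝ} (hx : 0 < x) (hx1 : x ≤ 1) :
    IsLazyReversible (transitionMatrix G x) (psMeasure G x) := by
  have hlazy : ∀ A, 1 / 2 ≤ transitionMatrix G x A A := fun A => by
    rw [transitionMatrix, if_pos rfl]
    have := sum_moveProbability_le hx1 A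
    linarith
  refine ⟨fun A => ?_, ?_, fun A B => ?_, transitionMatrix_row_sum x, fun A B => ?_, hlazy⟩
  · have h3 : (0 : ℝ) < Fintype.card V := Nat.cast_pos.mpr Fintype.card_pos
    have h4 : 0 < psi G A := by
      rw [psi]
      split_ifs
      · exact h3
      · norm_num
    exact div_pos (mul_pos (pow_pos hx _) h4) (normalization_pos hx)
  · have h1 := Finset.sum_coe_sort (configurations G)
      fun A => x ^ A.card * multiplicity G A / normalization G x
    exact h1.trans (by
      rw [← Finset.sum_div, sum_pow_mul_multiplicity, div_self (normalization_pos hx).ne'])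
  · by_cases h : A = B
    · subst h
      linarith [hlazy A]
    · rw [transitionMatrix, if_neg h]
      exact moveProbability_nonneg hx.le A B
  · rw [psMeasure_mul_transitionMatrix, psMeasure_mul_transitionMatrix, flow_comm hx]

theorem sum_neighborPairs_le [Nonempty V] {x : ℝ} (hx : 0 < x) (hx1 : x ≤ 1) (h : Finset (Sym2 V) → ℝ) :
    ∑ p ∈ neighborPairs G, x ^ (p.1 ∪ p.2).card * (h p.1 - h p.2) ^ 2 ≤
      2 * G.maxDegree * ∑ A : State G, ∑ B : State G, flow x A B * (h A - h B) ^ 2 := by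
  rw [neighborPairs, Finset.sum_filter, Finset.sum_product,
    ← Finset.sum_coe_sort (configurations G), Finset.mul_sum]
  refine Finset.sum_le_sum fun A _ => ?_
  rw [← Finset.sum_coe_sort (configurations G), Finset.mul_sum]
  refine Finset.sum_le_sum fun B _ => ?_
  split_ifs with he
  · obtain ⟨e, he, hB⟩ := he
    induction e using Sym2.ind with
    | _ u v =>
      have huv : G.Adj u v := SimpleGraph.mem_edgeFinset.mp he
      have h1 := le_flow hx hx1 (A := A) (B := B) huv hB
      have h2 : (0 : ℝ) < G.maxDegree :=
        lt_of_lt_of_le (degree_pos_of_adj huv) (Nat.cast_le.mpr (G.degree_le_maxDegree u))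
      have h3 : x ^ ((A : Finset (Sym2 V)) ∪ B).card ≤ 2 * G.maxDegree * flow x A B := by
        have := mul_le_mul_of_nonneg_left h1 (show (0 : ℝ) ≤ 2 * G.maxDegree by positivity)
        refine le_trans (le_of_eq ?_) this
        field_simp
      rw [← mul_assoc]
      exact mul_le_mul_of_nonneg_right h3 (sq_nonneg _)
  · have h1 := isLazyReversible_transitionMatrix (G := G) hx hx1
    have h2 : 0 ≤ flow x A B := by
      have h4 := mul_nonneg (h1.pos A).le (h1.nonneg A B)
      rw [psMeasure_mul_transitionMatrix] at h4
      exact nonneg_of_mul_nonneg_left (by simpa [div_eq_mul_inv] using h4)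
        (inv_pos.mpr (normalization_pos hx))
    positivity

/-- The Poincaré inequality for the worm process. -/
theorem poincare [Nonempty V] {x : ℝ} (hx : 0 < x) (hx1 : x ≤ 1) {f : State G → ℝ}
    (hf : mean (psMeasure G x) f = 0) :
    mean (psMeasure G x) (f * f) ≤
      4 * G.maxDegree * G.edgeFinset.card * (Fintype.card V : ℝ) ^ 2 *
        (mean (psMeasure G x) (f * f) -
          mean (psMeasure G x) (f * (transitionMatrix G x).mulVec f)) := by
  have hL := isLazyReversible_transitionMatrix (G := G) hx hx1
  have hZ := normalization_pos (G := G) hx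
  have hZ0 := weight_zero_pos (G := G) hx
  set Z := normalization G x
  set Z0 := weight x (oddFamily G 0)
  -- The canonical paths are stated for functions of all edge sets, so f is extended by 0; the
  -- values outside W are never used.
  set h : Finset (Sym2 V) → ℝ := fun A => if hA : A ∈ configurations G then f ⟨A, hA⟩ else 0
    with hh
  have hf' : ∀ A : State G, h A = f A := fun A => dif_pos A.2
  -- Centring at the weighted average over C_0 can only increase the second moment, and by Jensen it
  -- suffices to compare each configuration with the even ones.
  set c := (∑ F ∈ oddFamily G 0, x ^ F.card * h F) / Z0 with hc
  have jensen : ∀ a, Z0 * (a - c) ^ 2 ≤ ∑ F ∈ oddFamily G 0, x ^ F.card * (a - h F) ^ 2 := by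
    intro a
    have h1 : ∑ F ∈ oddFamily G 0, x ^ F.card * ((a - c) ^ 2 + 2 * (a - c) * (c - h F)) =
        Z0 * (a - c) ^ 2 := by
      have e : ∀ F : Finset (Sym2 V), x ^ F.card * ((a - c) ^ 2 + 2 * (a - c) * (c - h F)) =
          x ^ F.card * ((a - c) ^ 2 + 2 * (a - c) * c) - 2 * (a - c) * (x ^ F.card * h F) :=
        fun F => by ring
      simp only [e, Finset.sum_sub_distrib, ← Finset.sum_mul, ← Finset.mul_sum]
      have h2 : ∑ F ∈ oddFamily G 0, x ^ F.card * h F = c * Z0 := by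
        rw [hc, div_mul_cancel₀ _ hZ0.ne']
      rw [h2]
      change Z0 * _ - _ = _
      ring
    rw [← h1]
    refine Finset.sum_le_sum fun F _ => mul_le_mul_of_nonneg_left ?_ (pow_nonneg hx.le _)
    nlinarith [sq_nonneg (c - h F)]
  have hvar : mean (psMeasure G x) (f * f) ≤
      ∑ A : State G, psMeasure G x A * (h A - c) ^ 2 := by
    have e : ∑ A : State G, psMeasure G x A * (h A - c) ^ 2 =
        mean (psMeasure G x) (f * f - (2 * c) • f + fun _ => c ^ 2) := by
      refine Finset.sum_congr rfl fun A _ => ?_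
      simp only [hf', Pi.add_apply, Pi.sub_apply, Pi.mul_apply, Pi.smul_apply, smul_eq_mul]
      ring
    rw [e, mean_add, mean_sub, mean_smul, hf, hL.mean_const]
    nlinarith [sq_nonneg c]
  have hsum : ∑ A : State G, psMeasure G x A * (h A - c) ^ 2 =
      (∑ A ∈ configurations G, multiplicity G A * x ^ A.card * (h A - c) ^ 2) / Z := by
    rw [Finset.sum_div, ← Finset.sum_coe_sort (configurations G)]
    refine Finset.sum_congr rfl fun A _ => ?_
    have : psMeasure G x A = multiplicity G A * x ^ (A : Finset (Sym2 V)).card / Z := by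
      rw [mul_comm (multiplicity G _)]
      rfl
    rw [this]
    ring
  have hpath := sum_configurations_sq_le (G := G) hx.le hx1 h
  have hpairs := sum_neighborPairs_le (G := G) hx hx1 h
  have hdir : ∑ A : State G, ∑ B : State G, flow x A B * (h A - h B) ^ 2 =
      Z * (2 * (mean (psMeasure G x) (f * f) -
        mean (psMeasure G x) (f * (transitionMatrix G x).mulVec f))) := by
    rw [← hL.dirichlet_eq, Finset.mul_sum]
    refine Finset.sum_congr rfl fun A _ => ?_
    rw [Finset.mul_sum]
    refine Finset.sum_congr rfl fun B _ => ?_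
    rw [psMeasure_mul_transitionMatrix, hf', hf']
    change _ = Z * (_ / Z * _)
    field_simp
  rw [hdir] at hpairs
  set D := mean (psMeasure G x) (f * f) -
    mean (psMeasure G x) (f * (transitionMatrix G x).mulVec f)
  have h1 : Z0 * ∑ A ∈ configurations G, multiplicity G A * x ^ A.card * (h A - c) ^ 2 ≤
      G.edgeFinset.card * ((Fintype.card V : ℝ) ^ 2 * Z0) *
        (2 * G.maxDegree * (Z * (2 * D))) := by
    refine le_trans ?_ (hpath.trans (mul_le_mul_of_nonneg_left hpairs (by positivity)))
    rw [Finset.mul_sum]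
    refine Finset.sum_le_sum fun A _ => ?_
    calc _ = multiplicity G A * x ^ A.card * (Z0 * (h A - c) ^ 2) := by ring
      _ ≤ multiplicity G A * x ^ A.card * ∑ F ∈ oddFamily G 0, x ^ F.card * (h A - h F) ^ 2 :=
          mul_le_mul_of_nonneg_left (jensen _)
            (mul_nonneg (multiplicity_nonneg A) (pow_nonneg hx.le _))
      _ = _ := by
          rw [Finset.mul_sum]
          exact Finset.sum_congr rfl fun F _ => by ring
  refine hvar.trans ?_
  rw [hsum, div_le_iff₀ hZ]
  refine le_of_mul_le_mul_left (h1.trans (le_of_eq ?_)) hZ0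
  ring

/-- Since n ≥ 2, the normalization is at most n times the total weight of W, and W has at most 2^m
elements of weight at most 1. -/
theorem two_pow_inv_le_psMeasure_empty {x : ℝ} (hx : 0 < x) (hx1 : x ≤ 1)
    (hn : 2 ≤ Fintype.card V) :
    ((2 : ℝ) ^ G.edgeFinset.card)⁻¹ ≤ psMeasure G x (emptyState G) := by
  have : Nonempty V := Fintype.card_pos_iff.mp (by omega)
  have hn' : (2 : ℝ) ≤ Fintype.card V := by exact_mod_cast hn
  have h0 : weight x (oddFamily G 0) + weight x (oddFamily G 2) ≤ 2 ^ G.edgeFinset.card := by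
    rw [weight, weight, ← Finset.sum_union disjoint_oddFamily]
    have h1 : oddFamily G 0 ∪ oddFamily G 2 ⊆ G.edgeFinset.powerset :=
      fun A hA => Finset.mem_powerset.mpr (mem_configurations.mp hA).1
    have h2 := Finset.card_le_card h1
    rw [Finset.card_powerset] at h2
    refine (Finset.sum_le_sum fun A _ => pow_le_one₀ hx.le hx1).trans ?_
    rw [Finset.sum_const, nsmul_eq_mul, mul_one]
    exact_mod_cast h2
  have h1 := weight_nonneg hx.le (oddFamily G 2)
  have h2 : psMeasure G x (emptyState G) = Fintype.card V / normalization G x := by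
    have : psi G (emptyState G) = Fintype.card V := if_pos empty_mem_oddFamily
    rw [psMeasure, this]
    simp [emptyState, normalization]
  rw [h2, le_div_iff₀ (normalization_pos hx), inv_mul_le_iff₀ (by positivity), normalization]
  nlinarith

end Stationarity

/-! ### Chebyshev's inequality after burn-in -/

section Concentration

/-- The deviation of the sample mean of a lazy reversible Markov chain with relaxation time
at most `T`. -/
theorem IsMarkovChain.measureReal_deviation_le {S : Type u} [Fintype S] [DecidableEq S]
    {Ω : Type v} [MeasurableSpace Ω] {μ : Measure Ω} [IsProbabilityMeasure μ]
    {P : Matrix S S ℝ} {π : S → ℝ} {s₀ : S} {X : ℕ → Ω → S}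
    (hX : IsMarkovChain P s₀ μ X) (hL : IsLazyReversible P π) {T : ℝ} (hT : 1 < T)
    (gap : ∀ f, mean π f = 0 →
      mean π (f * f) ≤ T * (mean π (f * f) - mean π (f * P.mulVec f)))
    {f : S → ℝ} (hf : ∀ a, 0 ≤ f a) {B : ℝ} (hB : ∀ a, f a ≤ B) (hE : 0 < mean π f)
    {ε d : ℝ} (hε : 0 < ε) (hd : 0 ≤ d) {N τ : ℕ} (hN : 0 < N)
    (hτ : ((1 - 1 / T) ^ τ) ^ 2 ≤ π s₀ * d ^ 2) :
    μ.real {ω | ε * mean π f ≤ |sampleMean X f τ N ω - mean π f|} ≤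
      2 * T * B / (N * ε ^ 2 * mean π f) + d := by
  have hT0 : 0 < T := by linarith
  have hN' : (0 : ℝ) < N := Nat.cast_pos.mpr hN
  have hl : 0 < 1 - 1 / T := by
    rw [sub_pos, div_lt_one hT0]
    exact hT
  have hl1 : 1 - 1 / T < 1 := by
    have : 0 < 1 / T := by positivity
    linarith
  have gap' : ∀ f, mean π f = 0 →
      mean π (f * P.mulVec f) ≤ (1 - 1 / T) * mean π (f * f) := by
    intro f hf
    have h1 := gap f hf
    rw [← div_le_iff₀' hT0] at h1
    have e : (1 - 1 / T) * mean π (f * f) = mean π (f * f) - mean π (f * f) / T := by ring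
    linarith
  set E := mean π f with hEdef
  set g : S → ℝ := f - fun _ => E with hg
  set c : ℝ := N * (ε * E) with hc
  have hc0 : 0 < c := by positivity
  have hg0 : mean π g = 0 := by rw [hg, mean_sub, hL.mean_const, sub_self]
  have hset : {ω | ε * E ≤ |sampleMean X f τ N ω - E|} =
      {ω | c ≤ |∑ i ∈ Finset.Icc (τ + 1) (τ + N), g (X i ω)|} := by
    ext ω
    have e : ∑ i ∈ Finset.Icc (τ + 1) (τ + N), g (X i ω) = N * (sampleMean X f τ N ω - E) := by
      simp only [hg, Pi.sub_apply, Finset.sum_sub_distrib, Finset.sum_const, Nat.card_Icc,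
        nsmul_eq_mul, sampleMean]
      rw [show τ + N + 1 - (τ + 1) = N by omega]
      field_simp
    rw [Set.mem_ofPred_eq, Set.mem_ofPred_eq, e, abs_mul, abs_of_pos hN', hc]
    exact (mul_le_mul_iff_right₀ hN').symm
  rw [hset, hX.measureReal_tail]
  set W := tailProb P g c N 0
  -- Cost of starting at s₀ rather than at stationarity: W takes values in [0, 1], so the mixing
  -- bound applies to it.
  have h1 : P.mulVec^[τ] W s₀ - mean π W ≤ d := by
    have h2 := (hL.abs_iterate_sub_mean_le hl gap' (hL.tailProb_nonneg g c N 0)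
      (hL.tailProb_le_one g c N 0) s₀ τ).trans hτ
    exact abs_le_of_sq_le_sq' (le_of_mul_le_mul_left h2 (hL.pos s₀)) hd |>.2
  have h2 : mean π W ≤ 2 * T * B / (N * ε ^ 2 * E) := by
    have h3 : c ^ 2 * mean π W ≤ mean π (secondMoment P g N) := by
      rw [← mean_smul]
      refine mean_mono (fun a => (hL.pos a).le) fun a => ?_
      have := hL.sq_mul_tailProb_le g hc0.le N 0 a
      simpa using this
    have h4 := hL.mean_secondMoment_le hl hl1 gap' hg0 N
    have h5 : mean π (g * g) ≤ B * E := by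
      have e : g * g = f * f - (2 * E) • f + fun _ => E ^ 2 := by
        ext a
        simp only [hg, Pi.mul_apply, Pi.sub_apply, Pi.smul_apply, Pi.add_apply, smul_eq_mul]
        ring
      rw [e, mean_add, mean_sub, mean_smul, hL.mean_const, ← hEdef]
      have h6 : mean π (f * f) ≤ B * E := by
        rw [hEdef, ← mean_smul]
        exact mean_mono (fun a => (hL.pos a).le) fun a =>
          mul_le_mul_of_nonneg_right (hB a) (hf a)
      nlinarith [sq_nonneg E]
    have e : 2 / (1 - (1 - 1 / T)) = 2 * T := by
      field_simp
      ring
    rw [e] at h4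
    have h6 : c ^ 2 * mean π W ≤ 2 * T * N * (B * E) :=
      h3.trans (h4.trans (mul_le_mul_of_nonneg_left h5 (by positivity)))
    rw [le_div_iff₀ (by positivity)]
    refine le_of_mul_le_mul_left (a := N * E) ?_ (by positivity)
    calc N * E * (mean π W * (N * ε ^ 2 * E)) = c ^ 2 * mean π W := by rw [hc]; ring
      _ ≤ _ := h6
      _ = _ := by ring
  linarith

theorem isApproximation_of_deviation_le {Ω : Type v} [MeasurableSpace Ω] {μ : Measure Ω}
    [IsProbabilityMeasure μ] {Y : Ω → ℝ} {y ε δ : ℝ}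
    (h : μ.real {ω | ε * y ≤ |Y ω - y|} ≤ δ) : IsApproximation μ Y y ε δ := by
  have h1 : {ω | |Y ω - y| ≤ ε * y} ∪ {ω | ε * y ≤ |Y ω - y|} = Set.univ := by
    ext ω
    simpa using le_total _ _
  have h2 := measureReal_union_le (μ := μ) {ω | |Y ω - y| ≤ ε * y} {ω | ε * y ≤ |Y ω - y|}
  rw [h1, probReal_univ] at h2
  rw [IsApproximation]
  linarith

end Concentration

/-! ### Burn-in time and sample size -/

section Sampling

variable {V : Type u} [Fintype V] [DecidableEq V] {G : SimpleGraph V} [DecidableRel G.Adj]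

omit [DecidableEq V] in
theorem exists_adj_of_one_le_card_edgeFinset (hm : 1 ≤ G.edgeFinset.card) :
    ∃ u v, G.Adj u v := by
  obtain ⟨e, he⟩ := Finset.card_pos.mp hm
  induction e using Sym2.ind with
  | _ u v => exact ⟨u, v, SimpleGraph.mem_edgeFinset.mp he⟩

omit [DecidableEq V] [DecidableRel G.Adj] in
theorem two_le_card_of_adj {u v : V} (huv : G.Adj u v) : 2 ≤ Fintype.card V :=
  Fintype.one_lt_card_iff.mpr ⟨u, v, huv.ne⟩

omit [DecidableEq V] in
theorem one_le_maxDegree_of_adj {u v : V} (huv : G.Adj u v) : 1 ≤ G.maxDegree :=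
  ((G.degree_pos_iff_exists_adj u).mpr ⟨v, huv⟩).trans_le (G.degree_le_maxDegree u)

variable (G) in
/-- The bound on the relaxation time of the worm process. -/
noncomputable def relaxationBound : ℝ :=
  4 * G.maxDegree * G.edgeFinset.card * (Fintype.card V : ℝ) ^ 4

omit [DecidableEq V] in
theorem one_lt_relaxationBound (hm : 1 ≤ G.edgeFinset.card) : 1 < relaxationBound G := by
  obtain ⟨u, v, huv⟩ := exists_adj_of_one_le_card_edgeFinset hm
  have h1 : (1 : ℝ) ≤ G.maxDegree := by exact_mod_cast one_le_maxDegree_of_adj huv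
  have h2 : (1 : ℝ) ≤ G.edgeFinset.card := by exact_mod_cast hm
  have h3 : (1 : ℝ) ≤ (Fintype.card V : ℝ) ^ 4 := by
    refine one_le_pow₀ ?_
    exact_mod_cast (by have := two_le_card_of_adj huv; omega : 1 ≤ Fintype.card V)
  have h4 : 1 ≤ G.maxDegree * G.edgeFinset.card * (Fintype.card V : ℝ) ^ 4 :=
    one_le_mul_of_one_le_of_one_le (one_le_mul_of_one_le_of_one_le h1 h2) h3
  rw [relaxationBound]
  linarith

/-- The factor n² is weakened to the n⁴ that appears in τ and N_0, using that the Dirichlet form is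
nonnegative. -/
theorem poincare_relaxationBound (hm : 1 ≤ G.edgeFinset.card) {x : ℝ} (hx : 0 < x)
    (hx1 : x ≤ 1) {f : State G → ℝ} (hf : mean (psMeasure G x) f = 0) :
    mean (psMeasure G x) (f * f) ≤ relaxationBound G *
      (mean (psMeasure G x) (f * f) -
        mean (psMeasure G x) (f * (transitionMatrix G x).mulVec f)) := by
  obtain ⟨u, v, huv⟩ := exists_adj_of_one_le_card_edgeFinset hm
  have : Nonempty V := ⟨u⟩
  have hL := isLazyReversible_transitionMatrix (G := G) hx hx1
  refine (poincare hx hx1 hf).trans (mul_le_mul_of_nonneg_right ?_ ?_)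
  · refine mul_le_mul_of_nonneg_left (pow_le_pow_right₀ ?_ (by norm_num)) (by positivity)
    exact_mod_cast (by have := two_le_card_of_adj huv; omega : 1 ≤ Fintype.card V)
  · have h1 := hL.dirichlet_eq f
    have h2 : 0 ≤ ∑ A, ∑ B, psMeasure G x A * transitionMatrix G x A B * (f A - f B) ^ 2 :=
      Finset.sum_nonneg fun A _ => Finset.sum_nonneg fun B _ =>
        mul_nonneg (mul_nonneg (hL.pos A).le (hL.nonneg A B)) (sq_nonneg _)
    linarith

omit [DecidableEq V] in
theorem burnIn_eq_ceil (hm : 1 ≤ G.edgeFinset.card) (δ : ℝ) :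
    burnIn G δ = ⌈relaxationBound G *
      (G.edgeFinset.card * Real.log 2 + Real.log (2 * δ⁻¹))⌉₊ := by
  have : (0 : ℝ) < G.edgeFinset.card := by exact_mod_cast hm
  rw [burnIn, relaxationBound]
  congr 1
  field_simp

/-- The logarithms in τ give (1 - 1/T)^τ ≤ 2^(-m) δ/2. After squaring, one of the two factors 2^(-m)
is absorbed by π(∅) and the other is bounded by 1. -/
theorem decay_burnIn (hm : 1 ≤ G.edgeFinset.card) {x : ℝ} (hx : 0 < x) (hx1 : x ≤ 1)
    {δ : ℝ} (hδ : 0 < δ) :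
    ((1 - 1 / relaxationBound G) ^ burnIn G δ) ^ 2 ≤
      psMeasure G x (emptyState G) * (δ / 2) ^ 2 := by
  obtain ⟨u, v, huv⟩ := exists_adj_of_one_le_card_edgeFinset hm
  have hT := one_lt_relaxationBound hm
  have hT0 : 0 < relaxationBound G := by linarith
  have hl : 0 ≤ 1 - 1 / relaxationBound G := by
    rw [sub_nonneg, div_le_one hT0]
    exact hT.le
  set T := relaxationBound G
  set m := G.edgeFinset.card
  have h1 : (1 - 1 / T) ^ burnIn G δ ≤ ((2 : ℝ) ^ m)⁻¹ * (δ / 2) := by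
    calc (1 - 1 / T) ^ burnIn G δ ≤ Real.exp (-(1 / T)) ^ burnIn G δ :=
          pow_le_pow_left₀ hl (Real.one_sub_le_exp_neg _) _
      _ = Real.exp (burnIn G δ * -(1 / T)) := (Real.exp_nat_mul _ _).symm
      _ ≤ Real.exp (-(m * Real.log 2) - Real.log (2 * δ⁻¹)) := by
          refine Real.exp_le_exp.mpr ?_
          have h2 := Nat.le_ceil (T * (m * Real.log 2 + Real.log (2 * δ⁻¹)))
          rw [← burnIn_eq_ceil hm, ← le_div_iff₀' hT0] at h2
          have e : burnIn G δ * -(1 / T) = -((burnIn G δ : ℝ) / T) := by ring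
          rw [e]
          linarith
      _ = ((2 : ℝ) ^ m)⁻¹ * (δ / 2) := by
          rw [Real.exp_sub, Real.exp_neg, Real.exp_nat_mul, Real.exp_log (by norm_num),
            Real.exp_log (by positivity)]
          field_simp
  have h2 : ((2 : ℝ) ^ m)⁻¹ ≤ 1 := inv_le_one_of_one_le₀ (one_le_pow₀ (by norm_num))
  have h3 : (0 : ℝ) < ((2 : ℝ) ^ m)⁻¹ := by positivity
  calc ((1 - 1 / T) ^ burnIn G δ) ^ 2 ≤ (((2 : ℝ) ^ m)⁻¹ * (δ / 2)) ^ 2 :=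
        pow_le_pow_left₀ (pow_nonneg hl _) h1 2
    _ = ((2 : ℝ) ^ m)⁻¹ * ((2 : ℝ) ^ m)⁻¹ * (δ / 2) ^ 2 := by ring
    _ ≤ psMeasure G x (emptyState G) * (δ / 2) ^ 2 := by
        refine mul_le_mul_of_nonneg_right ?_ (sq_nonneg _)
        exact (mul_le_of_le_one_left h3.le h2).trans
          (two_pow_inv_le_psMeasure_empty hx hx1 (two_le_card_of_adj huv))

theorem psExpectation_pos [Nonempty V] {x : ℝ} (hx : 0 < x) (hx1 : x ≤ 1) {f : State G → ℝ}
    (hf : ∀ A, 0 ≤ f A) (hf1 : ∃ A, 0 < f A) : 0 < psExpectation G x f := by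
  have hL := isLazyReversible_transitionMatrix (G := G) hx hx1
  obtain ⟨A, hA⟩ := hf1
  exact Finset.sum_pos' (fun B _ => mul_nonneg (hL.pos B).le (hf B))
    ⟨A, Finset.mem_univ A, mul_pos (hL.pos A) hA⟩

theorem le_norm_apply (f : State G → ℝ) (A : State G) : f A ≤ ‖f‖ :=
  (le_abs_self _).trans (norm_le_pi_norm f A)

theorem psExpectation_le_norm [Nonempty V] {x : ℝ} (hx : 0 < x) (hx1 : x ≤ 1)
    (f : State G → ℝ) : psExpectation G x f ≤ ‖f‖ := by
  have hL := isLazyReversible_transitionMatrix (G := G) hx hx1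
  have h : psExpectation G x f ≤ mean (psMeasure G x) fun _ => ‖f‖ :=
    mean_mono (fun A => (hL.pos A).le) (le_norm_apply f)
  rwa [hL.mean_const] at h

theorem sampleSize_eq_ceil (x : ℝ) (f : State G → ℝ) (ε δ : ℝ) :
    sampleSize G x f ε δ = ⌈4 * relaxationBound G *
      ((ε ^ 2)⁻¹ * δ⁻¹ * (‖f‖ / psExpectation G x f))⌉₊ := by
  rw [sampleSize, relaxationBound]
  congr 1
  ring

/-- The error δ is split evenly: N_0 makes the Chebyshev term at most δ/2, and the burn-in accounts
for the other half. -/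
theorem deviation_le (hm : 1 ≤ G.edgeFinset.card) {x : ℝ} (hx : 0 < x) (hx1 : x ≤ 1)
    {f : State G → ℝ} (hf : ∀ A, 0 ≤ f A) (hf1 : ∃ A, 0 < f A) {ε δ : ℝ} (hε : 0 < ε)
    (hδ : 0 < δ) {Ω : Type v} [MeasurableSpace Ω] {μ : Measure Ω} [IsProbabilityMeasure μ]
    {X : ℕ → Ω → State G} (hX : IsMarkovChain (transitionMatrix G x) (emptyState G) μ X)
    {N : ℕ} (hN : sampleSize G x f ε δ ≤ N) :
    μ.real {ω | ε * psExpectation G x f ≤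
      |sampleMean X f (burnIn G δ) N ω - psExpectation G x f|} ≤ δ := by
  obtain ⟨u, v, huv⟩ := exists_adj_of_one_le_card_edgeFinset hm
  have : Nonempty V := ⟨u⟩
  have hE := psExpectation_pos hx hx1 hf hf1
  have hEn := psExpectation_le_norm hx hx1 f
  have hT := one_lt_relaxationBound hm
  have hNc : 4 * relaxationBound G * ((ε ^ 2)⁻¹ * δ⁻¹ * (‖f‖ / psExpectation G x f)) ≤ N := by
    rw [sampleSize_eq_ceil] at hN
    exact Nat.ceil_le.mp hN
  have hf0 : 0 < ‖f‖ := hE.trans_le hEn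
  have hN0 : (0 : ℝ) < N := by
    refine lt_of_lt_of_le ?_ hNc
    have : 0 < relaxationBound G := by linarith
    positivity
  have h1 := hX.measureReal_deviation_le
    (isLazyReversible_transitionMatrix hx hx1) hT
    (fun f hf => poincare_relaxationBound hm hx hx1 hf) hf (le_norm_apply f) hE hε
    (half_pos hδ).le (Nat.cast_pos.mp hN0) (decay_burnIn hm hx hx1 hδ)
  refine h1.trans ?_
  have h2 : 2 * relaxationBound G * ‖f‖ / (N * ε ^ 2 * psExpectation G x f) ≤ δ / 2 := by
    rw [div_le_iff₀ (mul_pos (by positivity) hE)]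
    have h3 := mul_le_mul_of_nonneg_left hNc
      (show 0 ≤ δ / 2 * ε ^ 2 * psExpectation G x f by positivity)
    refine le_trans (le_of_eq ?_) (h3.trans (le_of_eq ?_))
    · field_simp
      ring
    · ring
  calc _ ≤ δ / 2 + δ / 2 := add_le_add_left h2 _
    _ = δ := add_halves δ

theorem sampleSize_add_burnIn_le (hm : 1 ≤ G.edgeFinset.card) {x : ℝ} (hx : 0 < x)
    (hx1 : x ≤ 1) {f : State G → ℝ} (hf : ∀ A, 0 ≤ f A) (hf1 : ∃ A, 0 < f A) {ε δ : ℝ}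
    (hε : 0 < ε) (hε1 : ε < 1) (hδ : 0 < δ) (hδ1 : δ < 1) :
    ((sampleSize G x f ε δ + burnIn G δ : ℕ) : ℝ) ≤
      30 * (G.maxDegree * G.edgeFinset.card * (Fintype.card V : ℝ) ^ 4 *
        (G.edgeFinset.card + (ε ^ 2)⁻¹ * δ⁻¹ * (‖f‖ / psExpectation G x f))) := by
  obtain ⟨u, v, huv⟩ := exists_adj_of_one_le_card_edgeFinset hm
  have : Nonempty V := ⟨u⟩
  have hE := psExpectation_pos hx hx1 hf hf1
  have hr : 1 ≤ ‖f‖ / psExpectation G x f :=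
    (one_le_div hE).mpr (psExpectation_le_norm hx hx1 f)
  have hT := one_lt_relaxationBound hm
  have hm' : (1 : ℝ) ≤ G.edgeFinset.card := by exact_mod_cast hm
  have hεi : 1 ≤ (ε ^ 2)⁻¹ := (one_le_inv₀ (by positivity)).mpr (pow_le_one₀ hε.le hε1.le)
  have hδi : 1 ≤ δ⁻¹ := (one_le_inv₀ hδ).mpr hδ1.le
  have hq : δ⁻¹ ≤ (ε ^ 2)⁻¹ * δ⁻¹ * (‖f‖ / psExpectation G x f) :=
    (le_mul_of_one_le_left (by positivity) hεi).trans
      (le_mul_of_one_le_right (by positivity) hr)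
  have hlog2 : Real.log 2 ≤ 1 := by linarith [Real.log_two_lt_d9]
  have hlog2' : 0 ≤ Real.log 2 := Real.log_nonneg (by norm_num)
  have hlog : Real.log (2 * δ⁻¹) ≤ 2 * δ⁻¹ :=
    (Real.log_le_self (by positivity))
  have hlog' : 0 ≤ Real.log (2 * δ⁻¹) := Real.log_nonneg (by linarith)
  have e : (G.maxDegree * G.edgeFinset.card * (Fintype.card V : ℝ) ^ 4) =
      relaxationBound G / 4 := by
    rw [relaxationBound]
    ring
  rw [e, Nat.cast_add, sampleSize_eq_ceil, burnIn_eq_ceil hm]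
  set q := (ε ^ 2)⁻¹ * δ⁻¹ * (‖f‖ / psExpectation G x f)
  set T := relaxationBound G
  set m : ℝ := (G.edgeFinset.card : ℝ)
  have hq1 : 1 ≤ q := hδi.trans hq
  have c1 := (Nat.ceil_lt_add_one (show 0 ≤ 4 * T * q by positivity)).le
  have c2 := (Nat.ceil_lt_add_one
    (show 0 ≤ T * (m * Real.log 2 + Real.log (2 * δ⁻¹)) by positivity)).le
  have h1 : m * Real.log 2 + Real.log (2 * δ⁻¹) ≤ m + 2 * q := by
    have := mul_le_mul_of_nonneg_left hlog2 (show 0 ≤ m by linarith)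
    linarith
  have h2 := mul_le_mul_of_nonneg_left h1 (show 0 ≤ T by linarith)
  have h3 : 1 ≤ T * m := one_le_mul_of_one_le_of_one_le hT.le hm'
  have h4 : 1 ≤ T * q := one_le_mul_of_one_le_of_one_le hT.le hq1
  -- The total is at most 4Tq + T(m + 2q) + 2 ≤ 7Tq + 2Tm, which is below 30 · (T/4)(m + q); the two
  -- units from rounding up are absorbed by `h3` and `h4`.
  linarith

end Sampling

end Worm

theorem mainTheorem4 :
    ∃ C : ℝ, 0 < C ∧
      ∀ (V : Type u) [Fintype V] [DecidableEq V] (G : SimpleGraph V) [DecidableRel G.Adj],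
        G.Connected → 1 ≤ G.edgeFinset.card →
      ∀ x : ℝ, 0 < x → x < 1 →
      ∀ f : Worm.State G → ℝ, (∀ A, 0 ≤ f A) → (∃ A, 0 < f A) →
      ∀ ε δ : ℝ, 0 < ε → ε < 1 → 0 < δ → δ < 1 →
      ∀ (Ω : Type v) [MeasurableSpace Ω] (μ : MeasureTheory.Measure Ω)
        [MeasureTheory.IsProbabilityMeasure μ] (X : ℕ → Ω → Worm.State G),
        Worm.IsMarkovChain (Worm.transitionMatrix G x) (Worm.emptyState G) μ X →
        (∀ N : ℕ, Worm.sampleSize G x f ε δ ≤ N →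
          μ.real {ω | ε * Worm.psExpectation G x f ≤
            |Worm.sampleMean X f (Worm.burnIn G δ) N ω - Worm.psExpectation G x f|} ≤ δ ∧
          Worm.IsApproximation μ (Worm.sampleMean X f (Worm.burnIn G δ) N)
            (Worm.psExpectation G x f) ε δ) ∧
        ((Worm.sampleSize G x f ε δ + Worm.burnIn G δ : ℕ) : ℝ) ≤
          C * (G.maxDegree * G.edgeFinset.card * (Fintype.card V : ℝ) ^ 4 *
            (G.edgeFinset.card +
              (ε ^ 2)⁻¹ * δ⁻¹ * (‖f‖ / Worm.psExpectation G x f))) := by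
  refine ⟨30, by norm_num, ?_⟩
  intro V _ _ G _ _ hm x hx hx1 f hf hf1 ε δ hε hε1 hδ hδ1 Ω _ μ _ X hX
  refine ⟨fun N hN => ?_, Worm.sampleSize_add_burnIn_le hm hx hx1.le hf hf1 hε hε1 hδ hδ1⟩
  have h := Worm.deviation_le hm hx hx1.le hf hf1 hε hδ hX hN
  exact ⟨h, Worm.isApproximation_of_deviation_le h⟩
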